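/- Let $G$ be a countable infinite group with identity $e$, let $X_0$ be a standard Borel space and let $(\mu_g)_{g\in G}$ be a family of mutually equivalent probability measures on $X_0$ that are not supported on a single atom. Let $\nu$ be a probability measure on $X_0$. For $t\in[0,1]$ put $\mu_g^t=(1-t)\nu+t\mu_g$ and consider the Bernoulli action $$G\curvearrowright (X,\mu_t)=\prod_{g\in G}(X_0,\mu_g^t),\qquad (g\cdot x)_h=x_{g^{-1}h}.$$ Assume that $G\curvearrowright(X,\mu_1)=\prod_{g\in G}(X_0,\mu_g)$ is nonsingular, i.e. every $g\in G$ preserves the measure class of $\mu_1$. Then $G\curvearrowright (X,\mu_t)$ is nonsingular for every $t\in[0,1]$. Assume in addition that one of the following conditions holds: 1. $\nu\sim\mu_e$; 2. $\nu\prec\mu_e$ (absolutely continuous) and $\sup_{g\in G}\left|\log\frac{d\mu_g}{d\mu_e}(x)\right|<+\infty$ for $\mu_e$-a.e. $x\in X_0$. Then there exists $t_1\in[0,1]$ such that $G\curvearrowright(X,\mu_t)$ is weakly mixing for every $t\in[0,1]$ with $t<t_1$, and dissipative for every $t\in[0,1]$ with $t>t_1$; here, for $t=1>t_1$ and when the bound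 on the $\log\frac{d\mu_g}{d\mu_e}$ in condition 2 does not hold, dissipativity is claimed only if the product measure $\mu_1$ on $X$ has no atoms (without this assumption the action $G\curvearrowright(X,\mu_1)$ is still dissipative up to compact stabilizers). Terminology. A nonsingular action $G\curvearrowright(X,\mu)$ is *ergodic* if every $G$-invariant Borel set is null or conull; it is *weakly mixing* if for every ergodic probability measure preserving action $G\curvearrowright(Y,\eta)$ on a standard probability space the diagonal action $G\curvearrowright (X\times Y,\mu\times\eta)$ is ergodic; it is *dissipative up to compact stabilizers* if almost every ergodic component is of the form $G\curvearrowright G/K$ with $K$ a finite subgroup of $G$; it is *dissipative* if it is moreover essentially free, i.e. almost every point has trivial stabilizer. -/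

import Mathlib

open MeasureTheory ProbabilityTheory unitInterval

universe w v u

noncomputable section

/-! ### Actions of a countable discrete group on measure spaces -/

/-- The action of `G` on `(X, μ)` is nonsingular: every `g ∈ G` preserves the measure class of
`μ`, i.e. `g_* μ ∼ μ`. -/
def IsNonsingularAction (G : Type*) {X : Type*} [Group G] [MulAction G X] [MeasurableSpace X]
    [MeasurableConstSMul G X] (μ : Measure X) : Prop :=
  ∀ g : G, μ.map (fun x => g • x) ≪ μ ∧ μ ≪ μ.map (fun x => g • x)

/-- The action of `G` on `(X, μ)` is ergodic: every `G`-invariant measurable set is null or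
conull. -/
def IsErgodicAction (G : Type*) {X : Type*} [Group G] [MulAction G X] [MeasurableSpace X]
    (μ : Measure X) : Prop :=
  ∀ A : Set X, MeasurableSet A → (∀ g : G, (fun x => g • x) ⁻¹' A = A) → μ A = 0 ∨ μ Aᶜ = 0

/-- The action of `G` on `(X, μ)` is weakly mixing: for every ergodic probability measure
preserving action of `G` on a standard probability space `(Y, η)`, the diagonal action of `G` on
`(X × Y, μ × η)` is ergodic. -/
def IsWeaklyMixingAction (G : Type v) {X : Type u} [Group G] [MulAction G X]
    [MeasurableSpace X] (μ : Measure X) : Prop :=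
  ∀ (Y : Type w) [MeasurableSpace Y] [StandardBorelSpace Y] [MulAction G Y] (η : Measure Y)
    [IsProbabilityMeasure η],
    (∀ g : G, MeasurePreserving (fun y : Y => g • y) η η) → IsErgodicAction G η →
      IsErgodicAction G (μ.prod η)

/-- The action of `G` on `(X, μ)` is essentially free: almost every point has trivial
stabilizer. -/
def IsEssentiallyFreeAction (G : Type*) {X : Type*} [Group G] [MulAction G X] [MeasurableSpace X]
    (μ : Measure X) : Prop :=
  ∀ᵐ x ∂μ, MulAction.stabilizer G x = ⊥

/-- The σ-algebra of `G`-invariant measurable sets. -/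
@[reducible]
def invariantSigma (G : Type*) (X : Type*) [Group G] [MulAction G X] [MeasurableSpace X] :
    MeasurableSpace X :=
  ⨅ g : G, MeasurableSpace.invariants (fun x : X => g • x)

/-- The ergodic component through `x` of the action of a countable group `G` on the standard
finite measure space `(X, μ)`: the regular conditional measure at `x` of `μ` given the σ-algebra
of `G`-invariant sets. Thus `μ = ∫ ergodicComponent G μ x dμ(x)` is the ergodic decomposition
of the action. -/
def ergodicComponent (G : Type*) {X : Type*} [Group G] [MulAction G X] [MeasurableSpace X]
    [StandardBorelSpace X] (μ : Measure X) [IsFiniteMeasure μ] (x : X) : Measure X :=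
  condExpKernel μ (invariantSigma G X) x

/-- The action of `G` on `(X, ρ)` is of the form `G ↷ G / K` for a finite subgroup `K` (finite
being the same as compact for a discrete group). This means that for some point `z` with finite
stabilizer `K` the map `gK ↦ g • z` is a nonsingular isomorphism of `G / K` with its counting
measure onto `(X, ρ)`: the measure `ρ` is concentrated on the orbit of `z` and charges each of its
points. -/
def IsFiniteStabilizerOrbit (G : Type*) {X : Type*} [Group G] [MulAction G X] [MeasurableSpace X]
    (ρ : Measure X) : Prop :=
  ∃ z : X, Finite (MulAction.stabilizer G z) ∧ ρ (MulAction.orbit G z)ᶜ = 0 ∧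
    ∀ y ∈ MulAction.orbit G z, ρ {y} ≠ 0

/-- The action of the countable discrete group `G` on `(X, μ)` is dissipative up to compact (that
is, finite) stabilizers: almost every ergodic component is of the form `G ↷ G / K` with `K`
finite. -/
def IsDissipativeUpToCompactStabilizers (G : Type*) {X : Type*} [Group G] [MulAction G X]
    [MeasurableSpace X] [StandardBorelSpace X] (μ : Measure X) [IsFiniteMeasure μ] : Prop :=
  ∀ᵐ x ∂μ, IsFiniteStabilizerOrbit G (ergodicComponent G μ x)

/-- The action of the countable discrete group `G` on `(X, μ)` is dissipative: it is essentially
free and dissipative up to compact stabilizers. -/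
def IsDissipativeAction (G : Type*) {X : Type*} [Group G] [MulAction G X]
    [MeasurableSpace X] [StandardBorelSpace X] (μ : Measure X) [IsFiniteMeasure μ] : Prop :=
  IsEssentiallyFreeAction G μ ∧ IsDissipativeUpToCompactStabilizers G μ

/-! ### Bernoulli actions -/

/-- The space `∏_{g ∈ G} X₀` on which the Bernoulli action takes place. -/
def BernoulliSpace (G : Type*) (X₀ : Type*) : Type _ := G → X₀

instance instMeasurableSpaceBernoulliSpace (G X₀ : Type*) [MeasurableSpace X₀] :
    MeasurableSpace (BernoulliSpace G X₀) :=
  inferInstanceAs (MeasurableSpace (G → X₀))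

instance instStandardBorelSpaceBernoulliSpace (G X₀ : Type*) [Countable G] [MeasurableSpace X₀]
    [StandardBorelSpace X₀] : StandardBorelSpace (BernoulliSpace G X₀) :=
  inferInstanceAs (StandardBorelSpace (G → X₀))

/-- The Bernoulli action `(g • x)_h = x_{g⁻¹ h}`. -/
instance instMulActionBernoulliSpace (G X₀ : Type*) [Group G] :
    MulAction G (BernoulliSpace G X₀) where
  smul g x := fun h : G => x (g⁻¹ * h)
  one_smul x := funext fun h : G => by
    change x ((1 : G)⁻¹ * h) = x h
    simp
  mul_smul g k x := funext fun h : G => by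
    change x ((g * k)⁻¹ * h) = x (k⁻¹ * (g⁻¹ * h))
    simp [mul_assoc]

instance instMeasurableConstSMulBernoulliSpace (G X₀ : Type*) [Group G] [MeasurableSpace X₀] :
    MeasurableConstSMul G (BernoulliSpace G X₀) where
  measurable_const_smul g :=
    measurable_pi_lambda (fun (x : G → X₀) (h : G) => x (g⁻¹ * h))
      fun h => measurable_pi_apply (g⁻¹ * h)

/-- The product measure `∏_{g ∈ G} μ_g` on `∏_{g ∈ G} X₀`. -/
def bernoulliProductMeasure {G X₀ : Type*} [MeasurableSpace X₀] (μ : G → Measure X₀)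
    [∀ g, IsProbabilityMeasure (μ g)] : Measure (BernoulliSpace G X₀) :=
  Measure.infinitePi μ

instance instIsProbabilityMeasureBernoulliProductMeasure {G X₀ : Type*} [MeasurableSpace X₀]
    (μ : G → Measure X₀) [∀ g, IsProbabilityMeasure (μ g)] :
    IsProbabilityMeasure (bernoulliProductMeasure μ) :=
  inferInstanceAs (IsProbabilityMeasure (Measure.infinitePi μ))

/-- The family of convex combinations `μ_g^t = (1 - t) ν + t μ_g`, for `t ∈ [0, 1]`. -/
def mixture {G X₀ : Type*} [MeasurableSpace X₀] (ν : Measure X₀) (μ : G → Measure X₀) (t : I)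
    (g : G) : Measure X₀ :=
  ENNReal.ofReal (1 - (t : ℝ)) • ν + ENNReal.ofReal (t : ℝ) • μ g

instance instIsProbabilityMeasureMixture {G X₀ : Type*} [MeasurableSpace X₀] (ν : Measure X₀)
    [IsProbabilityMeasure ν] (μ : G → Measure X₀) [∀ g, IsProbabilityMeasure (μ g)] (t : I)
    (g : G) : IsProbabilityMeasure (mixture ν μ t g) where
  measure_univ := by
    simp only [mixture, Measure.coe_add, Measure.coe_smul, Pi.add_apply, Pi.smul_apply,
      measure_univ, smul_eq_mul, mul_one]
    rw [← ENNReal.ofReal_add (by linarith [t.2.2]) t.2.1]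
    simp

/-- `sup_{g ∈ G} |log (dμ_g / dμ_e)(x)| < ∞` for `μ_e`-almost every `x`. -/
def HasBoundedLogDensities {G X₀ : Type*} [Group G] [MeasurableSpace X₀] (μ : G → Measure X₀) :
    Prop :=
  ∀ᵐ x ∂(μ 1), ∃ C : ℝ, ∀ g : G, |Real.log ((μ g).rnDeriv (μ 1) x).toReal| ≤ C

end

/-! The transition is governed by the sum of all translates $\sum_g g_*\mu_t$ (`orbitMeasure`). If
it is σ-finite on a conull set, Borel–Cantelli gives sets covering almost everything to which almost
every orbit returns finitely often, and the action is dissipative up to finite stabilizers. If it is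
infinite on every set of positive measure, there are enough returns to run mixing arguments.

For $0<t<1$ only these two cases occur (`isOrbitSigmaFinite_or_isOrbitInfinite`). Either condition
on $\nu$ provides a finite measure below all $\mu_g^t$ and equivalent to them; it makes the largest
σ-finite piece insensitive to resampling one coordinate, and the zero-one law applies.

The parameters are compared by thinning: replacing each coordinate independently, with probability
$1-r$, by a fresh $\nu$-distributed value turns $\mu_t$ into $\mu_{rt}$. This map is equivariant
when the flags and values carry their Bernoulli action, which preserves measure. Hence
nonsingularity passes from $t$ to $rt$, and σ-finiteness passes from $rt$ to $t$
(`IsOrbitSigmaFinite.of_mixture_mul`). The threshold $t_1$ is the supremum of the parameters without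
σ-finiteness.

Below $t_1$, write $t=rs$ with $r<1$ and $s$ in the infinite case. An invariant set for
$\mu_t\times\eta$ lifts to $\mu_s\times\eta\times$ noise. Returns at group elements that separate
finite windows make its noise slices null or conull (`ae_slice_eq_zero_or_one`). Since each
coordinate is overwritten with positive probability, the slice value does not depend on any single
coordinate of $x$, and ergodicity of $\eta$ finishes (`isWeaklyMixingAction_of_isOrbitInfinite`).
Essential freeness above $t_1$ follows from the absence of atoms. -/

noncomputable section

/-! ### Resampling and the zero-one law for product measures -/

section ProductMeasures

open Measure

variable {ι α : Type*} [MeasurableSpace α] (μ : ι → Measure α) [∀ i, IsProbabilityMeasure (μ i)]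

open Classical in
/-- Replacing the coordinates outside `S` by those of an independent copy preserves a product
measure. -/
lemma measurePreserving_infinitePi_ite (S : Set ι) :
    MeasurePreserving (fun (p : (ι → α) × (ι → α)) (i : ι) => if i ∈ S then p.1 i else p.2 i)
      ((infinitePi μ).prod (infinitePi μ)) (infinitePi μ) := by
  have hm : Measurable
      (fun (p : (ι → α) × (ι → α)) (i : ι) => if i ∈ S then p.1 i else p.2 i) := by
    refine measurable_pi_lambda _ fun i => ?_
    by_cases h : i ∈ S <;> simp only [h, if_true, if_false] <;> fun_prop
  refine ⟨hm, eq_infinitePi _ fun s t ht => ?_⟩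
  have hpre : (fun (p : (ι → α) × (ι → α)) (i : ι) => if i ∈ S then p.1 i else p.2 i) ⁻¹'
      (Set.pi s t) = (Set.pi (s.filter (· ∈ S) : Finset ι) t) ×ˢ
        (Set.pi (s.filter (· ∉ S) : Finset ι) t) := by
    ext p
    simp only [Set.mem_preimage, Set.mem_pi, Finset.mem_coe, Set.mem_prod, Finset.mem_filter]
    constructor
    · intro h
      exact ⟨fun i hi => by simpa [hi.2] using h i hi.1, fun i hi => by simpa [hi.2] using h i hi.1⟩
    · rintro ⟨h1, h2⟩ i hi
      by_cases hS : i ∈ S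
      · simpa [hS] using h1 i ⟨hi, hS⟩
      · simpa [hS] using h2 i ⟨hi, hS⟩
  rw [map_apply hm (.pi s.countable_toSet fun i _ => ht i), hpre, prod_prod,
    infinitePi_pi _ fun i _ => ht i, infinitePi_pi _ fun i _ => ht i,
    Finset.prod_filter_mul_prod_filter_not]

open Classical in
/-- Resampling one coordinate preserves a product measure. -/
lemma measurePreserving_infinitePi_update (k : ι) :
    MeasurePreserving (fun p : (ι → α) × α => Function.update p.1 k p.2)
      ((infinitePi μ).prod (μ k)) (infinitePi μ) := by
  have hm : Measurable (fun p : (ι → α) × α => Function.update p.1 k p.2) := by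
    refine measurable_pi_lambda _ fun i => ?_
    by_cases h : i = k
    · subst h; simpa using measurable_snd
    · simp only [Function.update_of_ne h]; fun_prop
  refine ⟨hm, ?_⟩
  -- Only the coordinate `k` of the second copy is read, so that copy may be replaced by a single `μ
  -- k`-distributed point.
  have h1 := measurePreserving_infinitePi_ite μ ({k}ᶜ : Set ι)
  have h2 := (MeasurePreserving.id (infinitePi μ)).prod (measurePreserving_eval_infinitePi μ k)
  rw [← h2.map_eq, map_map hm h2.measurable]
  refine Eq.trans ?_ h1.map_eq
  congr 1
  ext p i
  by_cases h : i = k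
  · subst h; simp
  · simp [h]

/-- A coordinatewise map sends a product of two product measures to a product measure. -/
lemma measurePreserving_infinitePi_prod {β γ : Type*} [MeasurableSpace β] [MeasurableSpace γ]
    (ζ : ι → Measure β) [∀ i, IsProbabilityMeasure (ζ i)] (π : ι → Measure γ)
    [∀ i, IsProbabilityMeasure (π i)] {f : ι → α × β → γ}
    (hf : ∀ i, MeasurePreserving (f i) ((μ i).prod (ζ i)) (π i)) :
    MeasurePreserving (fun (p : (ι → α) × (ι → β)) (i : ι) => f i (p.1 i, p.2 i))
      ((infinitePi μ).prod (infinitePi ζ)) (infinitePi π) := by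
  have hm : Measurable (fun (p : (ι → α) × (ι → β)) (i : ι) => f i (p.1 i, p.2 i)) :=
    measurable_pi_lambda _ fun i => (hf i).measurable.comp (by fun_prop)
  refine ⟨hm, eq_infinitePi _ fun s t ht => ?_⟩
  have hS : MeasurableSet (Set.pi (s : Set ι) t) := .pi s.countable_toSet fun i _ => ht i
  have hmeas : ∀ i, Measurable fun b => μ i ((fun a => f i (a, b)) ⁻¹' t i) := fun i =>
    measurable_measure_prodMk_right ((hf i).measurable (ht i))
  rw [map_apply hm hS, prod_apply_symm (hm hS)]
  calc _ = ∫⁻ z, ∏ i ∈ s, μ i ((fun a => f i (a, z i)) ⁻¹' t i) ∂(infinitePi ζ) := by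
        refine lintegral_congr fun z => ?_
        rw [← infinitePi_pi μ (s := s) (t := fun i => (fun a => f i (a, z i)) ⁻¹' t i) fun i _ =>
          ((hf i).measurable.comp (by fun_prop)) (ht i)]
        congr 1
    _ = ∏ i ∈ s, ∫⁻ z, μ i ((fun a => f i (a, z i)) ⁻¹' t i) ∂(infinitePi ζ) :=
        lintegral_prod_eq_prod_lintegral_of_indepFun s _
          (iIndepFun_infinitePi (P := ζ) (X := fun i b => μ i ((fun a => f i (a, b)) ⁻¹' t i)) hmeas)
          fun i => (hmeas i).comp (measurable_pi_apply i)
    _ = _ := by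
        refine Finset.prod_congr rfl fun i _ => ?_
        rw [(measurePreserving_eval_infinitePi ζ i).lintegral_comp (hmeas i),
          ← (hf i).measure_preimage (ht i).nullMeasurableSet,
          prod_apply_symm ((hf i).measurable (ht i))]
        rfl

open Classical in
/-- Zero-one law: a set that is almost surely insensitive to resampling any single coordinate is
null or conull for a product measure. -/
lemma infinitePi_eq_zero_or_one_of_update {A : Set (ι → α)} (hA : MeasurableSet A)
    (h : ∀ k, ∀ᵐ p ∂(infinitePi μ).prod (μ k), p.1 ∈ A ↔ Function.update p.1 k p.2 ∈ A) :
    infinitePi μ A = 0 ∨ infinitePi μ A = 1 := by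
  -- `A` is independent of every finite box: resampling the coordinate `k` leaves `A` and the other
  -- constraints alone and makes the new value independent of them.
  have key : ∀ (s : Finset ι) (t : ι → Set α), (∀ i, MeasurableSet (t i)) →
      infinitePi μ (A ∩ Set.pi s t) = infinitePi μ A * ∏ i ∈ s, μ i (t i) := by
    intro s t ht
    induction s using Finset.induction_on with
    | empty => simp
    | insert k s hk ih =>
      set E := A ∩ Set.pi (s : Set ι) t with hE
      have hEm : MeasurableSet E := hA.inter (.pi s.countable_toSet fun i _ => ht i)
      have hset : A ∩ Set.pi (insert k s : Finset ι) t = E ∩ (fun x => x k) ⁻¹' t k := by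
        ext x
        simp only [hE, Finset.coe_insert, Set.insert_pi, Set.mem_inter_iff,
          Set.mem_preimage, Function.eval]
        tauto
      have hP := measurePreserving_infinitePi_update μ k
      rw [hset, ← hP.measure_preimage
        (hEm.inter (measurable_pi_apply k (ht k))).nullMeasurableSet,
        Finset.prod_insert hk, mul_comm (μ k (t k)), ← mul_assoc, ← ih, ← prod_prod]
      refine measure_congr ?_
      filter_upwards [h k] with p hp
      have h1 : (Function.update p.1 k p.2 ∈ Set.pi (s : Set ι) t) ↔ p.1 ∈ Set.pi (s : Set ι) t := by
        simp only [Set.mem_pi]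
        refine forall₂_congr fun i hi => ?_
        rw [Function.update_of_ne (fun h => hk (by simpa [h] using hi))]
      apply propext
      change (Function.update p.1 k p.2 ∈ E ∩ (fun x => x k) ⁻¹' t k) ↔ (p.1 ∈ E ∧ p.2 ∈ t k)
      simp only [hE, Set.mem_inter_iff, h1, hp, Set.mem_preimage, Function.update_self]
  by_cases h0 : infinitePi μ A = 0
  · exact Or.inl h0
  right
  have hfin : infinitePi μ A ≠ ⊤ := measure_ne_top _ _
  -- The product measure conditioned on `A` agrees with the product measure on boxes, hence
  -- everywhere; so it charges nothing outside `A`.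
  have hcond : (infinitePi μ A)⁻¹ • (infinitePi μ).restrict A = infinitePi μ := by
    refine eq_infinitePi _ fun s t ht => ?_
    rw [Measure.smul_apply, restrict_apply (.pi s.countable_toSet fun i _ => ht i), Set.inter_comm,
      key s t ht, smul_eq_mul, ← mul_assoc, ENNReal.inv_mul_cancel h0 hfin, one_mul]
  have h1 : infinitePi μ Aᶜ = 0 := by
    rw [← hcond, Measure.smul_apply, restrict_apply hA.compl]; simp
  simpa [h1] using prob_add_prob_compl (μ := infinitePi μ) hA

end ProductMeasures

/-! ### Sums of translates of a measure -/

section OrbitMeasure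

variable (G : Type*) {X : Type*} [Group G] [MulAction G X] [MeasurableSpace X]

/-- The sum of all translates of `μ` under the action of `G`. -/
def orbitMeasure (μ : Measure X) : Measure X :=
  Measure.sum fun g : G => μ.map (fun x => g • x)

/-- The sum of the translates of `μ` is `σ`-finite on a conull set. -/
def IsOrbitSigmaFinite (μ : Measure X) : Prop :=
  ∃ s : ℕ → Set X, (∀ n, MeasurableSet (s n)) ∧ (∀ n, orbitMeasure G μ (s n) ≠ ⊤) ∧
    μ (⋃ n, s n)ᶜ = 0

/-- The sum of the translates of `μ` is infinite on every set of positive measure. -/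
def IsOrbitInfinite (μ : Measure X) : Prop :=
  ∀ A : Set X, MeasurableSet A → μ A ≠ 0 → orbitMeasure G μ A = ⊤

instance instSFiniteOrbitMeasure [Countable G] (μ : Measure X) [SFinite μ] :
    SFinite (orbitMeasure G μ) := by
  unfold orbitMeasure; infer_instance

variable [MeasurableConstSMul G X]

lemma orbitMeasure_apply (μ : Measure X) {A : Set X} (hA : MeasurableSet A) :
    orbitMeasure G μ A = ∑' g : G, μ ((fun x => g • x) ⁻¹' A) := by
  rw [orbitMeasure, Measure.sum_apply _ hA]
  exact tsum_congr fun g => Measure.map_apply (measurable_const_smul g) hA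

lemma orbitMeasure_map {Y : Type*} [MulAction G Y] [MeasurableSpace Y] [MeasurableConstSMul G Y]
    (μ : Measure X) {f : X → Y} (hf : Measurable f) (hfg : ∀ (g : G) x, f (g • x) = g • f x) :
    orbitMeasure G (μ.map f) = (orbitMeasure G μ).map f := by
  ext A hA
  rw [orbitMeasure_apply G _ hA, Measure.map_apply hf hA, orbitMeasure_apply G _ (hf hA)]
  refine tsum_congr fun g => ?_
  rw [Measure.map_apply hf (measurable_const_smul g hA)]
  congr 1
  ext x
  simp [hfg]

lemma map_smul_prod {Z : Type*} [MulAction G Z] [MeasurableSpace Z]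
    (μ : Measure X) [SFinite μ] (ζ : Measure Z) [SFinite ζ] (g : G)
    (hζ : MeasurePreserving (fun z : Z => g • z) ζ ζ) :
    (μ.prod ζ).map (fun p => g • p) = (μ.map fun x => g • x).prod ζ := by
  conv_rhs => rw [← hζ.map_eq]
  rw [Measure.map_prod_map _ _ (measurable_const_smul g) hζ.measurable]
  rfl

lemma orbitMeasure_prod [Countable G] {Z : Type*} [MulAction G Z] [MeasurableSpace Z]
    (μ : Measure X) [SFinite μ] (ζ : Measure Z) [SFinite ζ]
    (hζ : ∀ g : G, MeasurePreserving (fun z : Z => g • z) ζ ζ) :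
    orbitMeasure G (μ.prod ζ) = (orbitMeasure G μ).prod ζ := by
  rw [orbitMeasure, orbitMeasure, Measure.prod_sum_left]
  congr 1
  funext g
  exact map_smul_prod G μ ζ g (hζ g)

end OrbitMeasure

/-! ### Thinning and monotonicity in the parameter -/

section Thinning

variable {G : Type v} {X₀ : Type u}

/-- Replace the coordinates of `x` flagged by `z` with those of `z`. -/
def thin (x : BernoulliSpace G X₀) (z : BernoulliSpace G (X₀ × Bool)) : BernoulliSpace G X₀ :=
  fun h => if (z h).2 then (z h).1 else x h

lemma thin_smul [Group G] (g : G) (x : BernoulliSpace G X₀) (z : BernoulliSpace G (X₀ × Bool)) :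
    thin (g • x) (g • z) = g • thin x z := rfl

variable [MeasurableSpace X₀]

lemma measurable_thin :
    Measurable fun p : BernoulliSpace G X₀ × BernoulliSpace G (X₀ × Bool) => thin p.1 p.2 :=
  measurable_pi_lambda _ fun h => by
    have h2 : Measurable fun p : (G → X₀) × (G → X₀ × Bool) => p.2 h := by fun_prop
    exact Measurable.ite (h2.snd (measurableSet_singleton true)) h2.fst (by fun_prop)

lemma bernoulliProductMeasure_mixture_one (ν : Measure X₀) [IsProbabilityMeasure ν]
    (μ : G → Measure X₀) [∀ g, IsProbabilityMeasure (μ g)] :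
    bernoulliProductMeasure (mixture ν μ 1) = bernoulliProductMeasure μ := by
  have h : mixture ν μ 1 = μ := by funext g; simp [mixture]
  congr!

lemma map_smul_bernoulliProductMeasure [Group G] (μ : G → Measure X₀) [∀ g, IsProbabilityMeasure (μ g)]
    (g : G) :
    (bernoulliProductMeasure μ).map (fun x => g • x) =
      bernoulliProductMeasure fun h => μ (g⁻¹ * h) :=
  Measure.map_infinitePi_infinitePi_of_inj (P := μ) (mul_right_injective g⁻¹)

/-- The law of a `ν`-distributed point together with an independent flag of probability `1 - r`. -/
def flaggedMeasure (ν : Measure X₀) (r : I) : Measure (X₀ × Bool) :=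
  ν.prod (ENNReal.ofReal (1 - (r : ℝ)) • Measure.dirac true +
    ENNReal.ofReal (r : ℝ) • Measure.dirac false)

instance instIsProbabilityMeasureFlag (r : I) :
    IsProbabilityMeasure (ENNReal.ofReal (1 - (r : ℝ)) • Measure.dirac true +
      ENNReal.ofReal (r : ℝ) • Measure.dirac false : Measure Bool) where
  measure_univ := by
    simp only [Measure.coe_add, Measure.coe_smul, Pi.add_apply, Pi.smul_apply,
      measure_univ, smul_eq_mul, mul_one]
    rw [← ENNReal.ofReal_add (by linarith [r.2.2]) r.2.1]
    simp

instance instIsProbabilityMeasureFlaggedMeasure (ν : Measure X₀) [IsProbabilityMeasure ν] (r : I) :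
    IsProbabilityMeasure (flaggedMeasure ν r) := by
  unfold flaggedMeasure; infer_instance

lemma flaggedMeasure_preimage_true (ν : Measure X₀) [IsProbabilityMeasure ν] (r : I) :
    flaggedMeasure ν r (Prod.snd ⁻¹' {true}) = ENNReal.ofReal (1 - (r : ℝ)) := by
  have : (Prod.snd ⁻¹' {true} : Set (X₀ × Bool)) = Set.univ ×ˢ {true} := by ext; simp
  rw [flaggedMeasure, this, Measure.prod_prod]
  simp

/-- The law of the flags and replacement values used to thin a Bernoulli action. -/
def noiseMeasure (G : Type v) (ν : Measure X₀) [IsProbabilityMeasure ν] (r : I) :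
    Measure (BernoulliSpace G (X₀ × Bool)) :=
  bernoulliProductMeasure fun _ : G => flaggedMeasure ν r

instance instIsProbabilityMeasureNoiseMeasure (ν : Measure X₀) [IsProbabilityMeasure ν] (r : I) :
    IsProbabilityMeasure (noiseMeasure G ν r) := by
  unfold noiseMeasure; infer_instance

lemma measurePreserving_smul_noiseMeasure [Group G] (ν : Measure X₀) [IsProbabilityMeasure ν] (r : I)
    (g : G) : MeasurePreserving (fun z => g • z) (noiseMeasure G ν r) (noiseMeasure G ν r) :=
  ⟨measurable_const_smul g, map_smul_bernoulliProductMeasure _ g⟩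

/-- The identity behind thinning is $(1-r)\nu+r((1-t)\nu+t\mu_h)=(1-rt)\nu+rt\mu_h$. -/
lemma measurePreserving_thin_coordinate (ν : Measure X₀) [IsProbabilityMeasure ν]
    (μ : G → Measure X₀) [∀ g, IsProbabilityMeasure (μ g)] (t r : I) (h : G) :
    MeasurePreserving (fun q : X₀ × (X₀ × Bool) => if q.2.2 then q.2.1 else q.1)
      ((mixture ν μ t h).prod (flaggedMeasure ν r)) (mixture ν μ (r * t) h) := by
  have hm : Measurable (fun q : X₀ × (X₀ × Bool) => if q.2.2 then q.2.1 else q.1) :=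
    Measurable.ite ((measurable_snd.comp measurable_snd) (measurableSet_singleton true))
      (by fun_prop) (by fun_prop)
  refine ⟨hm, ?_⟩
  ext A hA
  have hpre : (fun q : X₀ × (X₀ × Bool) => if q.2.2 then q.2.1 else q.1) ⁻¹' A =
      (Set.univ ×ˢ (A ×ˢ {true})) ∪ (A ×ˢ (Set.univ ×ˢ {false})) := by
    ext ⟨a, b, c⟩
    cases c <;> simp
  have hdisj : Disjoint (Set.univ ×ˢ (A ×ˢ {true}) : Set (X₀ × (X₀ × Bool)))
      (A ×ˢ (Set.univ ×ˢ {false})) := by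
    rw [Set.disjoint_left]
    rintro ⟨a, b, c⟩ h1 h2
    simp at h1 h2
    simp [h1.2] at h2
  rw [Measure.map_apply hm hA, hpre, measure_union hdisj
    (hA.prod (MeasurableSet.univ.prod (measurableSet_singleton _))), Measure.prod_prod,
    Measure.prod_prod, flaggedMeasure, Measure.prod_prod, Measure.prod_prod]
  simp only [measure_univ, one_mul]
  simp only [mixture, Measure.coe_add, Measure.coe_smul, Pi.add_apply,
    Pi.smul_apply, smul_eq_mul, Measure.dirac_apply, Set.Icc.coe_mul]
  have e1 : ENNReal.ofReal (1 - (r : ℝ) * t) =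
      ENNReal.ofReal (1 - (r : ℝ)) + ENNReal.ofReal r * ENNReal.ofReal (1 - (t : ℝ)) := by
    rw [← ENNReal.ofReal_mul r.2.1, ← ENNReal.ofReal_add (by linarith [r.2.2])
      (mul_nonneg r.2.1 (by linarith [t.2.2]))]
    congr 1; ring
  rw [e1, ENNReal.ofReal_mul r.2.1]
  simp
  ring

lemma measurePreserving_thin (ν : Measure X₀) [IsProbabilityMeasure ν]
    (μ : G → Measure X₀) [∀ g, IsProbabilityMeasure (μ g)] (t r : I) :
    MeasurePreserving (fun p : BernoulliSpace G X₀ × BernoulliSpace G (X₀ × Bool) => thin p.1 p.2)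
      ((bernoulliProductMeasure (mixture ν μ t)).prod (noiseMeasure G ν r))
      (bernoulliProductMeasure (mixture ν μ (r * t))) :=
  measurePreserving_infinitePi_prod (mixture ν μ t) (fun _ => flaggedMeasure ν r)
    (mixture ν μ (r * t)) (measurePreserving_thin_coordinate ν μ t r)

/-- Thinning is equivariant and the noise is invariant, so each translate of the thinned measure is
the image of a translate of the original one; images preserve absolute continuity. -/
lemma isNonsingularAction_mixture_mul [Group G] (ν : Measure X₀) [IsProbabilityMeasure ν]
    (μ : G → Measure X₀) [∀ g, IsProbabilityMeasure (μ g)] (t r : I)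
    (h : IsNonsingularAction G (bernoulliProductMeasure (mixture ν μ t))) :
    IsNonsingularAction G (bernoulliProductMeasure (mixture ν μ (r * t))) := by
  intro g
  have hT := measurePreserving_thin ν μ t r
  have hmap : (bernoulliProductMeasure (mixture ν μ (r * t))).map (fun x => g • x) =
      (((bernoulliProductMeasure (mixture ν μ t)).map (fun x => g • x)).prod
        (noiseMeasure G ν r)).map (fun p => thin p.1 p.2) := by
    rw [← map_smul_prod G _ _ g (measurePreserving_smul_noiseMeasure ν r g), ← hT.map_eq,
      Measure.map_map (measurable_const_smul g) hT.measurable,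
      Measure.map_map hT.measurable]
    · rfl
    · exact ((measurable_const_smul g).comp measurable_fst).prodMk
        ((measurable_const_smul g).comp measurable_snd)
  rw [hmap]
  conv in (occs := 2) bernoulliProductMeasure (mixture ν μ (r * t)) => rw [← hT.map_eq]
  conv in (occs := 1) bernoulliProductMeasure (mixture ν μ (r * t)) => rw [← hT.map_eq]
  exact ⟨((h g).1.prod .rfl).map hT.measurable, ((h g).2.prod .rfl).map hT.measurable⟩

/-- Upstairs the sum of translates is a product with the noise. By Fubini, almost every fixed noise
`z` pulls the given sets back to sets of finite orbit measure that still cover. Such a `z` need not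
be invariant, as σ-finiteness does not involve the action on the covering sets. -/
lemma IsOrbitSigmaFinite.of_mixture_mul [Group G] [Countable G] {ν : Measure X₀} [IsProbabilityMeasure ν]
    {μ : G → Measure X₀} [∀ g, IsProbabilityMeasure (μ g)] {t r : I}
    (h : IsOrbitSigmaFinite G (bernoulliProductMeasure (mixture ν μ (r * t)))) :
    IsOrbitSigmaFinite G (bernoulliProductMeasure (mixture ν μ t)) := by
  obtain ⟨s, hs, hfin, hcov⟩ := h
  have hT := measurePreserving_thin ν μ t r
  have hζ := measurePreserving_smul_noiseMeasure (G := G) ν r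
  set m := bernoulliProductMeasure (mixture ν μ t)
  set ζ := noiseMeasure G ν r
  have h1 : ∀ᵐ z ∂ζ, ∀ n, orbitMeasure G m ((fun x => thin x z) ⁻¹' s n) < ⊤ := by
    refine ae_all_iff.2 fun n => ae_lt_top ?_ ?_
    · exact measurable_measure_prodMk_right (hT.measurable (hs n))
    · have hn := hfin n
      have : MeasurableConstSMul G
          (BernoulliSpace G X₀ × BernoulliSpace G (X₀ × Bool)) :=
        ⟨fun g => ((measurable_const_smul g).comp measurable_fst).prodMk
          ((measurable_const_smul g).comp measurable_snd)⟩
      rw [← hT.map_eq, orbitMeasure_map G _ hT.measurable fun g p => thin_smul g p.1 p.2,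
        Measure.map_apply hT.measurable (hs n), orbitMeasure_prod G _ _ hζ,
        Measure.prod_apply_symm (hT.measurable (hs n))] at hn
      exact hn
  have h2 : ∀ᵐ z ∂ζ, m ((fun x => thin x z) ⁻¹' (⋃ n, s n)ᶜ) = 0 := by
    have hU := (MeasurableSet.iUnion hs).compl
    rw [← hT.measure_preimage hU.nullMeasurableSet, Measure.prod_apply_symm (hT.measurable hU),
      lintegral_eq_zero_iff (measurable_measure_prodMk_right (hT.measurable hU))] at hcov
    exact hcov
  obtain ⟨z, hz1, hz2⟩ := (h1.and h2).exists
  have hmz : Measurable fun x : BernoulliSpace G X₀ => thin x z :=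
    measurable_thin.comp (measurable_id.prodMk measurable_const)
  refine ⟨fun n => (fun x => thin x z) ⁻¹' s n, fun n => hmz (hs n), fun n => (hz1 n).ne, ?_⟩
  rw [← Set.preimage_iUnion]
  exact hz2

end Thinning

/-! ### The dichotomy: σ-finite or everywhere infinite -/

section Dichotomy

/-- The measures `μ g` have a common finite minorant in their measure class. -/
def HasCommonMinorant {G X₀ : Type*} [MeasurableSpace X₀] (μ : G → Measure X₀) : Prop :=
  ∃ ρ : Measure X₀, IsFiniteMeasure ρ ∧ (∀ g, ρ ≤ μ g) ∧ ∀ g, μ g ≪ ρ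

variable {G : Type v} {X₀ : Type u}

open Classical in
/-- Replace the `k`-th coordinate of `x` by `a`. -/
def resample (k : G) (x : BernoulliSpace G X₀) (a : X₀) : BernoulliSpace G X₀ :=
  Function.update (x : G → X₀) k a

open Classical in
lemma resample_of_ne {k h : G} (hk : h ≠ k) (x : BernoulliSpace G X₀) (a : X₀) :
    resample k x a h = x h :=
  Function.update_of_ne hk _ _

variable [MeasurableSpace X₀]

lemma measurePreserving_resample (μ : G → Measure X₀) [∀ g, IsProbabilityMeasure (μ g)] (k : G) :
    MeasurePreserving (fun p : BernoulliSpace G X₀ × X₀ => resample k p.1 p.2)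
      ((bernoulliProductMeasure μ).prod (μ k)) (bernoulliProductMeasure μ) :=
  measurePreserving_infinitePi_update μ k

lemma bernoulliProductMeasure_eq_zero_or_one (μ : G → Measure X₀)
    [∀ g, IsProbabilityMeasure (μ g)] {A : Set (BernoulliSpace G X₀)} (hA : MeasurableSet A)
    (h : ∀ k, ∀ᵐ p ∂(bernoulliProductMeasure μ).prod (μ k), p.1 ∈ A ↔ resample k p.1 p.2 ∈ A) :
    bernoulliProductMeasure μ A = 0 ∨ bernoulliProductMeasure μ A = 1 :=
  infinitePi_eq_zero_or_one_of_update μ hA h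

/-- The translate by `g` is a product measure whose `k`-th marginal is `μ (g⁻¹ * k)`. Since `ρ` lies
below all of these at once, one inequality serves all translates. -/
lemma lintegral_resample_orbitMeasure_le [Group G] (μ : G → Measure X₀) [∀ g, IsProbabilityMeasure (μ g)]
    {ρ : Measure X₀} [IsFiniteMeasure ρ] (hρ : ∀ g, ρ ≤ μ g) (k : G)
    {A : Set (BernoulliSpace G X₀)} (hA : MeasurableSet A) :
    ∫⁻ x, ρ {a | resample k x a ∈ A}
      ∂(orbitMeasure G (bernoulliProductMeasure μ)) ≤
        orbitMeasure G (bernoulliProductMeasure μ) A := by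
  rw [orbitMeasure, lintegral_sum_measure, Measure.sum_apply _ hA]
  refine ENNReal.tsum_le_tsum fun g => ?_
  rw [map_smul_bernoulliProductMeasure]
  have hP := measurePreserving_resample (fun h => μ (g⁻¹ * h)) k
  calc _ ≤ ∫⁻ x, μ (g⁻¹ * k) {a | resample k x a ∈ A}
        ∂(bernoulliProductMeasure fun h => μ (g⁻¹ * h)) :=
        lintegral_mono fun x => hρ _ _
    _ = _ := by
        rw [← hP.measure_preimage hA.nullMeasurableSet,
          Measure.prod_apply (hP.measurable hA)]
        rfl

/-- The zero-one law is applied to `D`, a largest set, up to `P`-null sets, on which the orbit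
measure `m` is σ-finite. -/
lemma isOrbitSigmaFinite_or_isOrbitInfinite [Group G] [Countable G] (μ : G → Measure X₀)
    [∀ g, IsProbabilityMeasure (μ g)] (hμ : HasCommonMinorant μ) :
    IsOrbitSigmaFinite G (bernoulliProductMeasure μ) ∨
      IsOrbitInfinite G (bernoulliProductMeasure μ) := by
  obtain ⟨ρ, hρfin, hρ, hac⟩ := hμ
  set P := bernoulliProductMeasure μ with hPdef
  set m := orbitMeasure G P with hm
  set D := m.sigmaFiniteSetWRT P with hD
  have hDm : MeasurableSet D := measurableSet_sigmaFiniteSetWRT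
  have hnull : ∀ A : Set (BernoulliSpace G X₀), A ⊆ Dᶜ → m A ≠ ⊤ → P A = 0 := fun A hA hfin =>
    by_contra fun h => hfin (measure_eq_top_of_subset_compl_sigmaFiniteSetWRT hA h)
  set s : ℕ → Set (BernoulliSpace G X₀) := fun n => spanningSets (m.restrict D) n ∩ D with hs
  have hsm : ∀ n, MeasurableSet (s n) := fun n => (measurableSet_spanningSets _ n).inter hDm
  have hsfin : ∀ n, m (s n) ≠ ⊤ := fun n => by
    rw [hs, ← Measure.restrict_apply (measurableSet_spanningSets _ n)]
    exact (measure_spanningSets_lt_top _ n).ne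
  have hsU : ⋃ n, s n = D := by
    rw [hs, ← Set.iUnion_inter, iUnion_spanningSets, Set.univ_inter]
  have hins : ∀ k, ∀ᵐ x ∂P, x ∉ D → ρ {a | resample k x a ∈ D} = 0 := by
    intro k
    have hupd := (measurePreserving_resample μ k).measurable
    have h1 : ∀ n, ∀ᵐ x ∂P, x ∉ D → ρ {a | resample k x a ∈ s n} = 0 := by
      intro n
      have hFm : Measurable fun x : BernoulliSpace G X₀ => ρ {a | resample k x a ∈ s n} :=
        measurable_measure_prodMk_left (hupd (hsm n))
      have hint : ∫⁻ x, ρ {a | resample k x a ∈ s n} ∂m ≠ ⊤ :=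
        ((lintegral_resample_orbitMeasure_le μ hρ k (hsm n)).trans_lt (hsfin n).lt_top).ne
      -- By Markov's inequality this set has finite `m`-measure; outside `D` finite `m`-measure
      -- forces `P`-measure zero.
      have h2 : ∀ j : ℕ, P (Dᶜ ∩ {x | ((j : ENNReal) + 1)⁻¹ ≤
          ρ {a | resample k x a ∈ s n}}) = 0 := by
        intro j
        refine hnull _ Set.inter_subset_left ?_
        refine ((measure_mono Set.inter_subset_right).trans_lt
          ((meas_ge_le_lintegral_div hFm.aemeasurable (by simp) (by simp)).trans_lt
            (ENNReal.div_lt_top hint (by simp)))).ne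
      refine measure_mono_null ?_ (measure_iUnion_null h2)
      intro x hx
      simp only [Set.mem_compl_iff, Set.mem_ofPred_eq, Classical.not_imp] at hx
      obtain ⟨j, hj⟩ := ENNReal.exists_inv_nat_lt hx.2
      refine Set.mem_iUnion.2 ⟨j, hx.1, ?_⟩
      exact (ENNReal.inv_le_inv.2 le_self_add).trans hj.le
    filter_upwards [ae_all_iff.2 h1] with x hx hxD
    have : {a | resample k x a ∈ D} =
        ⋃ n, {a | resample k x a ∈ s n} := by
      rw [← hsU]; ext a; simp only [Set.mem_iUnion, Set.mem_ofPred_eq]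
    rw [this]
    exact measure_iUnion_null fun n => hx n hxD
  have h01 : P D = 0 ∨ P D = 1 := by
    refine bernoulliProductMeasure_eq_zero_or_one μ hDm fun k => ?_
    have hP := measurePreserving_resample μ k
    have hS1 : MeasurableSet ((fun p : BernoulliSpace G X₀ × X₀ => resample k p.1 p.2) ⁻¹' D) :=
      hP.measurable hDm
    have hS2 : MeasurableSet (Prod.fst ⁻¹' D : Set (BernoulliSpace G X₀ × X₀)) := measurable_fst hDm
    have hsub : ∀ᵐ p ∂P.prod (μ k),
        resample k p.1 p.2 ∈ D → p.1 ∈ D := by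
      refine (Measure.ae_prod_iff_ae_ae (hS1.himp hS2)).2 ?_
      filter_upwards [hins k] with x hx
      by_cases hxD : x ∈ D
      · exact .of_forall fun a _ => hxD
      · have := hac k (hx hxD)
        rw [measure_eq_zero_iff_ae_notMem] at this
        filter_upwards [this] with a ha h
        exact absurd h ha
    -- One inclusion suffices, since both preimages have measure `P D`.
    have heq : ((fun p : BernoulliSpace G X₀ × X₀ => resample k p.1 p.2) ⁻¹' D)
        =ᵐ[P.prod (μ k)] (Prod.fst ⁻¹' D : Set (BernoulliSpace G X₀ × X₀)) := by
      refine ae_eq_of_ae_subset_of_measure_ge hsub ?_ hS1.nullMeasurableSet (measure_ne_top _ _)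
      rw [hP.measure_preimage hDm.nullMeasurableSet,
        measurePreserving_fst.measure_preimage hDm.nullMeasurableSet]
    filter_upwards [heq] with p hp
    exact (Iff.of_eq hp).symm
  rcases h01 with h0 | h1
  · right
    intro A hA hPA
    refine measure_eq_top_mono (Set.inter_subset_left (t := Dᶜ)) ?_
    refine measure_eq_top_of_subset_compl_sigmaFiniteSetWRT (ν := P)
      Set.inter_subset_right fun h => hPA ?_
    refine measure_mono_null (fun x hx => ?_) (measure_union_null h h0)
    by_cases hxD : x ∈ D
    · exact Or.inr hxD
    · exact Or.inl ⟨hx, hxD⟩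
  · left
    refine ⟨s, hsm, hsfin, ?_⟩
    rw [hsU]
    exact (prob_compl_eq_zero_iff hDm).2 h1

end Dichotomy

/-! ### Zero-one slices from infinitely many returns -/

section Mixing

-- Build the point from two independent copies, one on `S` and one off `S`: then `U` sees only the
-- first and `V` only the second.
open Classical in
lemma infinitePi_inter_of_dependsOn {ι α : Type*} [MeasurableSpace α] (μ : ι → Measure α)
    [∀ i, IsProbabilityMeasure (μ i)] {S T : Set ι} (hST : Disjoint S T) {U V : Set (ι → α)}
    (hU : MeasurableSet U) (hV : MeasurableSet V) (hUS : DependsOn (· ∈ U) S)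
    (hVT : DependsOn (· ∈ V) T) :
    Measure.infinitePi μ (U ∩ V) = Measure.infinitePi μ U * Measure.infinitePi μ V := by
  rw [← (measurePreserving_infinitePi_ite μ S).measure_preimage (hU.inter hV).nullMeasurableSet,
    ← Measure.prod_prod]
  congr 1
  ext p
  have h1 := hUS (x := fun i => if i ∈ S then p.1 i else p.2 i) (y := p.1) fun i hi => by simp [hi]
  have h2 := hVT (x := fun i => if i ∈ S then p.1 i else p.2 i) (y := p.2) fun i hi => by
    simp [Set.disjoint_right.1 hST hi]
  simp only [Set.mem_preimage, Set.mem_inter_iff, Set.mem_prod]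
  exact and_congr (Iff.of_eq h1) (Iff.of_eq h2)

/-- Measurable subsets of `P × BernoulliSpace ι α` depending on finitely many coordinates of the
second factor are dense for any finite measure. -/
lemma exists_cylinder_symmDiff_lt {ι α P : Type*} [MeasurableSpace α] [MeasurableSpace P]
    (κ : Measure (P × BernoulliSpace ι α)) [IsFiniteMeasure κ] {E : Set (P × BernoulliSpace ι α)}
    (hE : MeasurableSet E) {ε : ℝ} (hε : 0 < ε) :
    ∃ E' : Set (P × BernoulliSpace ι α), MeasurableSet E' ∧
      (∃ F : Finset ι, ∀ p, DependsOn (fun z : ι → α =>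
        (p, (z : BernoulliSpace ι α)) ∈ E') (F : Set ι)) ∧
      κ (symmDiff E E') < ENNReal.ofReal ε := by
  classical
  let 𝒜 : Set (Set (P × BernoulliSpace ι α)) := {E' | MeasurableSet E' ∧
      ∃ F : Finset ι, ∀ p, DependsOn (fun z : ι → α =>
        (p, (z : BernoulliSpace ι α)) ∈ E') (F : Set ι)}
  have halg : IsSetAlgebra 𝒜 := by
    refine ⟨⟨.empty, ∅, fun p z z' _ => rfl⟩, ?_, ?_⟩
    · rintro s ⟨hs, F, hF⟩
      exact ⟨hs.compl, F, fun p z z' h => congrArg Not (hF p h)⟩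
    · rintro s t ⟨hs, F, hF⟩ ⟨ht, F', hF'⟩
      refine ⟨hs.union ht, F ∪ F', fun p z z' h => congrArg₂ Or (hF p fun i hi => h i ?_)
        (hF' p fun i hi => h i ?_)⟩
      · simpa using Or.inl hi
      · simpa using Or.inr hi
  have hgen : (inferInstance : MeasurableSpace (P × BernoulliSpace ι α)) =
      MeasurableSpace.generateFrom 𝒜 := by
    refine le_antisymm (sup_le ?_ ?_) (MeasurableSpace.generateFrom_le fun s hs => hs.1)
    · rintro _ ⟨s, hs, rfl⟩
      exact MeasurableSpace.measurableSet_generateFrom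
        ⟨measurable_fst hs, ∅, fun p z z' _ => rfl⟩
    · rw [MeasurableSpace.comap_le_iff_le_map]
      refine iSup_le fun i => ?_
      rintro _ ⟨s, hs, rfl⟩
      refine MeasurableSpace.measurableSet_generateFrom
        ⟨(measurable_pi_apply (X := fun _ : ι => α) i).comp measurable_snd hs, {i}, fun p z z' h => ?_⟩
      change (z i ∈ s) = (z' i ∈ s)
      rw [h i (by simp)]
  obtain ⟨E', hE', h⟩ := (Measure.MeasureDense.of_generateFrom_isSetAlgebra_finite κ halg
    hgen).approx E hE (measure_ne_top _ _) ε hε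
  exact ⟨E', hE'.1, hE'.2, h⟩

/-- Rebasing at a point of the orbit that lies in `A` shows that at most `K.card` elements `g` send
`p` into `A`; integrate this bound. -/
lemma orbitMeasure_ne_top_of_finite_returns {G P : Type*} [Group G] [Countable G] [MulAction G P]
    [MeasurableSpace P] [MeasurableConstSMul G P] (π : Measure P) [IsFiniteMeasure π]
    {A : Set P} (hA : MeasurableSet A) (K : Finset G)
    (hK : ∀ p ∈ A, ∀ g : G, g • p ∈ A → g ∈ K) : orbitMeasure G π A ≠ ⊤ := by
  have hm : ∀ g : G, Measurable fun p : P => A.indicator (1 : P → ENNReal) (g • p) := fun g =>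
    (measurable_one.indicator hA).comp (measurable_const_smul g)
  have h1 : orbitMeasure G π A = ∫⁻ p, ∑' g : G, A.indicator (1 : P → ENNReal) (g • p) ∂π := by
    rw [orbitMeasure_apply G π hA, lintegral_tsum fun g => (hm g).aemeasurable]
    refine tsum_congr fun g => ?_
    rw [← lintegral_indicator_one (measurable_const_smul g hA)]
    rfl
  have h2 : ∀ p, ∑' g : G, A.indicator (1 : P → ENNReal) (g • p) ≤ K.card := by
    intro p
    by_cases h : ∃ g₀ : G, g₀ • p ∈ A
    · obtain ⟨g₀, hg₀⟩ := h
      rw [← (Equiv.mulRight g₀).tsum_eq fun g => A.indicator (1 : P → ENNReal) (g • p),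
        tsum_eq_sum (s := K)]
      · refine (Finset.sum_le_card_nsmul K _ 1 fun k _ => ?_).trans_eq (by simp)
        exact Set.indicator_le (fun _ _ => le_rfl) _
      · intro k hk
        refine Set.indicator_of_notMem (fun hmem => hk (hK _ hg₀ k ?_)) _
        simpa [mul_smul] using hmem
    · push Not at h
      simp [h]
  rw [h1]
  refine ((lintegral_mono h2).trans_lt ?_).ne
  rw [lintegral_const]
  exact ENNReal.mul_lt_top (by simp) (measure_lt_top _ _)

/-- The slice measure `e` is invariant. Approximate `E` by a set with finite window `F`. If `p` and
`g • p` are both well approximated and `g` moves `F` off itself, the same slice is close to two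
independent events, so `e` is close to its square. -/
lemma ae_slice_eq_zero_or_one {G : Type*} {P α : Type*} [Group G] [Countable G] [MulAction G P]
    [MeasurableSpace P] [MeasurableConstSMul G P] [MeasurableSpace α] (π : Measure P)
    [IsProbabilityMeasure π] (hπ : IsOrbitInfinite G π) (β : Measure α) [IsProbabilityMeasure β]
    {E : Set (P × BernoulliSpace G α)} (hE : MeasurableSet E)
    (hinv : ∀ (g : G) p z, (g • p, g • z) ∈ E ↔ (p, z) ∈ E) :
    ∀ᵐ p ∂π, bernoulliProductMeasure (fun _ : G => β) {z | (p, z) ∈ E} = 0 ∨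
      bernoulliProductMeasure (fun _ : G => β) {z | (p, z) ∈ E} = 1 := by
  classical
  set ζ := bernoulliProductMeasure (fun _ : G => β) with hζ
  have hζinv : ∀ g : G, MeasurePreserving (fun z => g • z) ζ ζ := fun g =>
    ⟨measurable_const_smul g, map_smul_bernoulliProductMeasure _ g⟩
  have hslice : ∀ {E : Set (P × BernoulliSpace G α)}, MeasurableSet E → ∀ p,
      MeasurableSet {z | (p, z) ∈ E} := fun hE p => measurable_prodMk_left hE
  set e : P → ℝ := fun p => ζ.real {z | (p, z) ∈ E} with he
  have hem : Measurable e := (measurable_measure_prodMk_left hE).ennreal_toReal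
  have he0 : ∀ p, 0 ≤ e p := fun p => measureReal_nonneg
  have he1 : ∀ p, e p ≤ 1 := fun p => measureReal_le_one
  have heinv : ∀ (g : G) p, e (g • p) = e p := by
    intro g p
    rw [he]
    simp only [measureReal_def]
    rw [← (hζinv g).measure_preimage (hslice hE (g • p)).nullMeasurableSet]
    congr 2
    ext z
    exact hinv g p z
  have hbad : ∀ n : ℕ, π {p | 1 / ((n : ℝ) + 1) < e p * (1 - e p)} = 0 := by
    intro n
    by_contra hR
    set c : ℝ := 1 / ((n : ℝ) + 1) with hc
    have hc0 : 0 < c := by positivity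
    set R := {p | c < e p * (1 - e p)} with hRdef
    have hRm : MeasurableSet R :=
      measurableSet_lt measurable_const (hem.mul (measurable_const.sub hem))
    have hRpos : 0 < π.real R := by
      rw [measureReal_def]; exact ENNReal.toReal_pos hR (measure_ne_top _ _)
    -- Four errors will occur: two in comparing `W` with `U ∩ V`, two in replacing the measures of
    -- `U` and `V` by `e p`.
    set ε := c / 4 with hε
    have hε0 : 0 < ε := by positivity
    -- The factor `π.real R` ensures, by Markov's inequality, that some positive part of `R` has
    -- slice error below `ε`.
    obtain ⟨E', hE', ⟨F, hF⟩, hlt⟩ := exists_cylinder_symmDiff_lt (π.prod ζ) hE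
      (mul_pos hε0 hRpos)
    have hSD : MeasurableSet (symmDiff E E') := hE.symmDiff hE'
    set d : P → ENNReal := fun p => ζ {z | (p, z) ∈ symmDiff E E'} with hd
    have hdm : Measurable d := measurable_measure_prodMk_left hSD
    set A := R ∩ {p | d p < ENNReal.ofReal ε} with hA
    have hAm : MeasurableSet A := hRm.inter (measurableSet_lt hdm measurable_const)
    have hApos : π A ≠ 0 := by
      intro h0
      have hle : ENNReal.ofReal ε * π R ≤ ∫⁻ p in R, d p ∂π := by
        rw [← setLIntegral_const]
        refine lintegral_mono_ae ?_
        rw [ae_restrict_iff' hRm]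
        have := measure_eq_zero_iff_ae_notMem.1 h0
        filter_upwards [this] with p hp hpR
        by_contra hlt
        exact hp ⟨hpR, not_le.1 hlt⟩
      have hle2 : ∫⁻ p in R, d p ∂π ≤ (π.prod ζ) (symmDiff E E') := by
        rw [Measure.prod_apply hSD]
        exact setLIntegral_le_lintegral _ _
      refine absurd (hle.trans hle2) (not_le.2 ?_)
      rw [ENNReal.ofReal_mul hε0.le, measureReal_def, ENNReal.ofReal_toReal (measure_ne_top _ _)]
        at hlt
      exact hlt
    -- The finite set is $FF^{-1}$: any other `g` makes $gF$ and $F$ disjoint. Infinite orbit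
    -- measure must yield a return to `A` by such a `g`.
    refine orbitMeasure_ne_top_of_finite_returns π hAm
      ((F ×ˢ F).image fun q => q.2 * q.1⁻¹) ?_ (hπ A hAm hApos)
    intro p hp g hgp
    by_contra hg
    set V := {z | (g • p, z) ∈ E'} with hV
    set U := (fun z => g⁻¹ • z) ⁻¹' {z | (p, z) ∈ E'} with hU
    set W := {z | (g • p, z) ∈ E} with hW
    have hVm : MeasurableSet V := hslice hE' _
    have hUm : MeasurableSet U := measurable_const_smul g⁻¹ (hslice hE' p)
    have hWm : MeasurableSet W := hslice hE _
    have hWp : W = (fun z => g⁻¹ • z) ⁻¹' {z | (p, z) ∈ E} := by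
      ext z
      change (g • p, z) ∈ E ↔ (p, g⁻¹ • z) ∈ E
      rw [← hinv g p (g⁻¹ • z), smul_inv_smul]
    have hind : ζ.real (U ∩ V) = ζ.real U * ζ.real V := by
      rw [measureReal_def, measureReal_def, measureReal_def, ← ENNReal.toReal_mul]
      congr 1
      refine infinitePi_inter_of_dependsOn (fun _ : G => β) (S := (F.image (g * ·) : Finset G))
        (T := F) ?_ hUm hVm ?_ (hF _)
      · rw [Set.disjoint_left]
        intro b hb hbF
        simp only [Finset.coe_image, Set.mem_image, Finset.mem_coe] at hb
        obtain ⟨a, ha, rfl⟩ := hb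
        exact hg (Finset.mem_image.2 ⟨(a, g * a), Finset.mem_product.2 ⟨ha, hbF⟩, by simp⟩)
      · intro z z' hzz
        refine hF p fun i hi => ?_
        change z (g⁻¹⁻¹ * i) = z' (g⁻¹⁻¹ * i)
        rw [inv_inv]
        exact hzz _ (by simpa using hi)
    have hVW : ζ.real (symmDiff W V) < ε := by
      have := hgp.2
      rw [Set.mem_ofPred_eq, ENNReal.lt_ofReal_iff_toReal_lt (measure_ne_top _ _)] at this
      exact this
    have hUW : ζ.real (symmDiff W U) < ε := by
      have := hp.2
      rw [Set.mem_ofPred_eq, ENNReal.lt_ofReal_iff_toReal_lt (measure_ne_top _ _)] at this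
      have h2 : symmDiff W U = (fun z => g⁻¹ • z) ⁻¹' {z | (p, z) ∈ symmDiff E E'} := by
        rw [hWp, hU]; rfl
      rw [h2, measureReal_def, (hζinv g⁻¹).measure_preimage (hslice hSD p).nullMeasurableSet]
      exact this
    have hWe : ζ.real W = e p := heinv g p
    have b1 : ζ.real W ≤ ζ.real (U ∩ V) + (ζ.real (symmDiff W U) + ζ.real (symmDiff W V)) := by
      refine (measureReal_mono ?_).trans ((measureReal_union_le _ _).trans
        (add_le_add le_rfl (measureReal_union_le _ _)))
      intro z hz
      by_cases h1 : z ∈ U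
      · by_cases h2 : z ∈ V
        · exact Or.inl ⟨h1, h2⟩
        · exact Or.inr (Or.inr (Or.inl ⟨hz, h2⟩))
      · exact Or.inr (Or.inl (Or.inl ⟨hz, h1⟩))
    have hsub : ∀ S : Set (BernoulliSpace G α), ζ.real S ≤ ζ.real W + ζ.real (symmDiff W S) := by
      intro S
      refine (measureReal_mono ?_).trans (measureReal_union_le _ _)
      intro z hz
      by_cases h1 : z ∈ W
      · exact Or.inl h1
      · exact Or.inr (Or.inr ⟨hz, h1⟩)
    have b2 := hsub U
    have b3 := hsub V
    have hpR : c < e p * (1 - e p) := hp.1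
    have u1 : ζ.real U ≤ 1 := measureReal_le_one
    have u0 : 0 ≤ ζ.real U := measureReal_nonneg
    have := he0 p
    have := he1 p
    rw [hind] at b1
    rw [hWe] at b1 b2 b3
    -- The hints give $uv\le u(e+\varepsilon)\le e^2+2\varepsilon$, hence $e\le
    -- e^2+4\varepsilon=e^2+c$, against `hpR`.
    nlinarith [mul_nonneg u0 (by linarith : 0 ≤ e p + ε - ζ.real V),
      mul_nonneg (he0 p) (by linarith : 0 ≤ e p + ε - ζ.real U),
      mul_nonneg (by linarith : 0 ≤ 1 - ζ.real U) hε0.le,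
      mul_nonneg (by linarith : 0 ≤ 1 - e p) hε0.le]
  have hall : ∀ᵐ p ∂π, ∀ n : ℕ, e p * (1 - e p) ≤ 1 / ((n : ℝ) + 1) := by
    refine ae_all_iff.2 fun n => ?_
    filter_upwards [measure_eq_zero_iff_ae_notMem.1 (hbad n)] with p hp
    exact not_lt.1 hp
  filter_upwards [hall] with p hp
  have hle : e p * (1 - e p) ≤ 0 := by
    by_contra hpos
    obtain ⟨n, hn⟩ := exists_nat_one_div_lt (not_le.1 hpos)
    exact absurd (hp n) (not_le.2 hn)
  have h3 : e p * (1 - e p) = 0 :=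
    le_antisymm hle (mul_nonneg (he0 p) (by linarith [he1 p]))
  rcases mul_eq_zero.1 h3 with h | h
  · left
    exact (measureReal_eq_zero_iff).1 h
  · right
    have h4 : ζ.real {z | (p, z) ∈ E} = 1 := by change e p = 1; linarith
    rw [measureReal_def, ENNReal.toReal_eq_one_iff] at h4
    exact h4

end Mixing

/-! ### Weak mixing below the threshold -/

section WeakMixing

lemma measurableConstSMul_prod {G P Q : Type*} [Group G] [MulAction G P] [MulAction G Q]
    [MeasurableSpace P] [MeasurableSpace Q] [MeasurableConstSMul G P] [MeasurableConstSMul G Q] :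
    MeasurableConstSMul G (P × Q) :=
  ⟨fun g => ((measurable_const_smul g).comp measurable_fst).prodMk
    ((measurable_const_smul g).comp measurable_snd)⟩

lemma IsOrbitInfinite.prod {G P Q : Type*} [Group G] [Countable G] [MulAction G P] [MulAction G Q]
    [MeasurableSpace P] [MeasurableSpace Q] [MeasurableConstSMul G P]
    {π : Measure P} [SFinite π] {η : Measure Q} [SFinite η]
    (hη : ∀ g : G, MeasurePreserving (fun y : Q => g • y) η η) (h : IsOrbitInfinite G π) :
    IsOrbitInfinite G (π.prod η) := by
  intro A hA h0
  rw [orbitMeasure_prod G π η hη, Measure.prod_apply_symm hA]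
  refine lintegral_eq_top_of_measure_eq_top_ne_zero
    (measurable_measure_prodMk_right hA).aemeasurable fun htop => h0 ?_
  rw [Measure.prod_apply_symm hA, lintegral_eq_zero_iff (measurable_measure_prodMk_right hA)]
  refine measure_mono_null (fun y hy => ?_) htop
  exact h _ (measurable_prodMk_right hA) hy

/-- Three zero-one statements are combined: noise slices over `(x, y)`, then the product zero-one
law in `x` for fixed `y`, then ergodicity in `y`. The strict bound `r < 1` makes every coordinate
replaceable with positive probability. -/
lemma isWeaklyMixingAction_of_isOrbitInfinite {G : Type v} [Group G] [Countable G] {X₀ : Type u}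
    [MeasurableSpace X₀] (ν : Measure X₀) [IsProbabilityMeasure ν]
    (μ : G → Measure X₀) [∀ g, IsProbabilityMeasure (μ g)] (t r : I) (hr : r < 1)
    (hns : IsNonsingularAction G (bernoulliProductMeasure (mixture ν μ (r * t))))
    (hinf : IsOrbitInfinite G (bernoulliProductMeasure (mixture ν μ t))) :
    IsWeaklyMixingAction.{w, v, max v u} G (bernoulliProductMeasure (mixture ν μ (r * t))) := by
  intro Y _ _ _ η _ hη herg E hE hEinv
  have : MeasurableConstSMul G Y := ⟨fun g => (hη g).measurable⟩
  have : MeasurableConstSMul G (BernoulliSpace G X₀ × Y) := measurableConstSMul_prod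
  have hT := measurePreserving_thin ν μ t r
  set m := bernoulliProductMeasure (mixture ν μ t) with hm
  set m' := bernoulliProductMeasure (mixture ν μ (r * t)) with hm'
  have hEinv' : ∀ (g : G) x y, (g • x, g • y) ∈ E ↔ (x, y) ∈ E := fun g x y =>
    Iff.of_eq (congrArg ((x, y) ∈ ·) (hEinv g))
  have hEy : ∀ y, MeasurableSet {x | (x, y) ∈ E} := fun y => measurable_prodMk_right hE
  let F : Set ((BernoulliSpace G X₀ × Y) × BernoulliSpace G (X₀ × Bool)) :=
    {q | (thin q.1.1 q.2, q.1.2) ∈ E}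
  have hF : MeasurableSet F :=
    ((hT.measurable.comp ((measurable_fst.comp measurable_fst).prodMk measurable_snd)).prodMk
      (measurable_snd.comp measurable_fst)) hE
  have hFinv : ∀ (g : G) p z, (g • p, g • z) ∈ F ↔ (p, z) ∈ F := fun g p z =>
    hEinv' g (thin p.1 z) p.2
  set ζ := noiseMeasure G ν r with hζ
  have h01 : ∀ᵐ p ∂m.prod η, ζ {z | (p, z) ∈ F} = 0 ∨ ζ {z | (p, z) ∈ F} = 1 :=
    ae_slice_eq_zero_or_one (m.prod η) (hinf.prod hη) (flaggedMeasure ν r) hF hFinv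
  have hφ : Measurable fun p => ζ {z | (p, z) ∈ F} := measurable_measure_prodMk_left hF
  have h01' : ∀ᵐ y ∂η, ∀ᵐ x ∂m, ζ {z | ((x, y), z) ∈ F} = 0 ∨ ζ {z | ((x, y), z) ∈ F} = 1 := by
    have hset : MeasurableSet {p : BernoulliSpace G X₀ × Y |
        ζ {z | (p, z) ∈ F} = 0 ∨ ζ {z | (p, z) ∈ F} = 1} :=
      (hφ (measurableSet_singleton 0)).union (hφ (measurableSet_singleton 1))
    exact (Measure.ae_ae_comm hset).1 (Measure.ae_ae_of_ae_prod h01)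
  have hY : ∀ᵐ y ∂η, m' {x | (x, y) ∈ E} = 0 ∨ m' {x | (x, y) ∈ E} = 1 := by
    filter_upwards [h01'] with y hy
    have hψ : Measurable fun x => ζ {z | ((x, y), z) ∈ F} := hφ.comp measurable_prodMk_right
    have hB : MeasurableSet {x | ζ {z | ((x, y), z) ∈ F} = 1} := hψ (measurableSet_singleton 1)
    have hint : m' {x | (x, y) ∈ E} = ∫⁻ x, ζ {z | ((x, y), z) ∈ F} ∂m := by
      rw [← hT.measure_preimage (hEy y).nullMeasurableSet,
        Measure.prod_apply (hT.measurable (hEy y))]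
      rfl
    have hBz : m {x | ζ {z | ((x, y), z) ∈ F} = 1} = 0 ∨
        m {x | ζ {z | ((x, y), z) ∈ F} = 1} = 1 := by
      refine bernoulliProductMeasure_eq_zero_or_one _ hB fun k => ?_
      have hres := measurePreserving_resample (mixture ν μ t) k
      have a1 := Measure.quasiMeasurePreserving_fst (μ := m) (ν := mixture ν μ t k) |>.ae hy
      have a2 := hres.quasiMeasurePreserving.ae hy
      -- On `N` the coordinate `k` is overwritten, so resampling it does not change the thinned
      -- point. As `N` has positive measure, a slice of measure one cannot become one of measure
      -- zero.
      let N : Set (BernoulliSpace G (X₀ × Bool)) := {z | (z k).2 = true}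
      have hN : ζ N ≠ 0 := by
        have hNeq : ζ N = flaggedMeasure ν r (Prod.snd ⁻¹' {true}) :=
          (measurePreserving_eval_infinitePi (fun _ : G => flaggedMeasure ν r) k).measure_preimage
            (measurable_snd (measurableSet_singleton true)).nullMeasurableSet
        rw [hNeq, flaggedMeasure_preimage_true]
        have : (r : ℝ) < 1 := hr
        simpa using this
      have hagree : ∀ (x : BernoulliSpace G X₀) (a : X₀), ∀ z ∈ N,
          ((resample k x a, y), z) ∈ F ↔ ((x, y), z) ∈ F := by
        intro x a z hz
        have : thin (resample k x a) z = thin x z := by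
          funext h
          by_cases hh : h = k
          · subst hh
            have hz' : (z h).2 = true := hz
            simp [thin, hz']
          · simp [thin, resample_of_ne hh]
        change (thin (resample k x a) z, y) ∈ E ↔ (thin x z, y) ∈ E
        rw [this]
      have hcontra : ∀ S S' : Set (BernoulliSpace G (X₀ × Bool)), MeasurableSet S →
          ζ S = 1 → ζ S' = 0 → (∀ z ∈ N, z ∈ S → z ∈ S') → False := by
        intro S S' hS h1 h0 hSS
        refine hN (measure_mono_null (t := Sᶜ ∪ S') (fun z hz => ?_)
          (measure_union_null ((prob_compl_eq_zero_iff hS).2 h1) h0))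
        by_cases hzS : z ∈ S
        · exact Or.inr (hSS z hz hzS)
        · exact Or.inl hzS
      have hsl : ∀ x, MeasurableSet {z | ((x, y), z) ∈ F} := fun x => measurable_prodMk_left hF
      filter_upwards [a1, a2] with p hp1 hp2
      constructor
      · intro h
        rcases hp2 with h0 | h1
        · exact (hcontra _ _ (hsl _) h h0 fun z hz hzS => (hagree p.1 p.2 z hz).2 hzS).elim
        · exact h1
      · intro h
        rcases hp1 with h0 | h1
        · exact (hcontra _ _ (hsl _) h h0 fun z hz hzS => (hagree p.1 p.2 z hz).1 hzS).elim
        · exact h1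
    rw [hint]
    rcases hBz with h0 | h1
    · left
      rw [lintegral_eq_zero_iff hψ]
      filter_upwards [hy, measure_eq_zero_iff_ae_notMem.1 h0] with x hx hx2
      exact hx.resolve_right hx2
    · right
      have : ∀ᵐ x ∂m, ζ {z | ((x, y), z) ∈ F} = 1 := (prob_compl_eq_zero_iff hB).2 h1
      rw [lintegral_congr_ae this]
      simp
  have hcompl : Measurable fun y => m' {x | (x, y) ∈ E}ᶜ := measurable_measure_prodMk_right hE.compl
  -- Moving `y` translates the slice, and nonsingularity keeps null sets null.
  have hYinv : ∀ g : G, (fun y : Y => g • y) ⁻¹' {y | m' {x | (x, y) ∈ E}ᶜ = 0} =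
      {y | m' {x | (x, y) ∈ E}ᶜ = 0} := by
    intro g
    ext y
    have hset : {x | (x, g • y) ∈ E}ᶜ = (fun x => g⁻¹ • x) ⁻¹' {x | (x, y) ∈ E}ᶜ := by
      ext x
      simp only [Set.mem_compl_iff, Set.mem_preimage, Set.mem_ofPred_eq]
      rw [← hEinv' g (g⁻¹ • x) y, smul_inv_smul]
    change m' {x | (x, g • y) ∈ E}ᶜ = 0 ↔ m' {x | (x, y) ∈ E}ᶜ = 0
    rw [hset, ← Measure.map_apply (measurable_const_smul g⁻¹) (hEy y).compl]
    exact ⟨fun h => (hns g⁻¹).2 h, fun h => (hns g⁻¹).1 h⟩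
  rcases herg _ (hcompl (measurableSet_singleton 0)) hYinv with h | h
  · left
    rw [Measure.prod_apply_symm hE, lintegral_eq_zero_iff (measurable_measure_prodMk_right hE)]
    filter_upwards [hY, measure_eq_zero_iff_ae_notMem.1 h] with y hy hy2
    exact hy.resolve_right fun h1 => hy2 ((prob_compl_eq_zero_iff (hEy y)).2 h1)
  · right
    rw [Measure.prod_apply_symm hE.compl,
      lintegral_eq_zero_iff (measurable_measure_prodMk_right hE.compl)]
    filter_upwards [measure_eq_zero_iff_ae_notMem.1 h] with y hy
    exact not_not.1 hy

end WeakMixing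

/-! ### Ergodic components and dissipativity -/

section Dissipative

variable {G X : Type*} [Group G] [MulAction G X] [MeasurableSpace X]

lemma measurableSet_invariantSigma_iff [Countable G] {s : Set X} :
    MeasurableSet[invariantSigma G X] s ↔
      MeasurableSet s ∧ ∀ g : G, (fun x => g • x) ⁻¹' s = s := by
  rw [invariantSigma, MeasurableSpace.measurableSet_iInf]
  simp only [MeasurableSpace.measurableSet_invariants]
  exact ⟨fun h => ⟨(h 1).1, fun g => (h g).2⟩, fun h g => ⟨h.1, h.2 g⟩⟩

lemma invariantSigma_le : invariantSigma G X ≤ (inferInstance : MeasurableSpace X) :=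
  (iInf_le _ (1 : G)).trans (MeasurableSpace.invariants_le _)

variable [StandardBorelSpace X] (μ : Measure X) [IsFiniteMeasure μ]

instance instIsProbabilityMeasureErgodicComponent (x : X) :
    IsProbabilityMeasure (ergodicComponent G μ x) := by
  unfold ergodicComponent; infer_instance

lemma measurable_ergodicComponent_apply {A : Set X} (hA : MeasurableSet A) :
    Measurable fun x => ergodicComponent G μ x A :=
  (measurable_condExpKernel hA).mono invariantSigma_le le_rfl

lemma lintegral_ergodicComponent {A : Set X} (hA : MeasurableSet A) :
    ∫⁻ x, ergodicComponent G μ x A ∂μ = μ A := by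
  have hI : invariantSigma G X ≤ (inferInstance : MeasurableSpace X) := invariantSigma_le
  conv_rhs => rw [← condExpKernel_comp_trim (μ := μ) hI]
  rw [Measure.bind_apply hA (Kernel.aemeasurable _), lintegral_trim hI
    (measurable_condExpKernel hA)]
  rfl

lemma ae_ergodicComponent_eq_zero {A : Set X} (hA : μ A = 0) :
    ∀ᵐ x ∂μ, ergodicComponent G μ x A = 0 := by
  have hm := measurableSet_toMeasurable μ A
  have h := lintegral_ergodicComponent (G := G) μ hm
  rw [measure_toMeasurable, hA, lintegral_eq_zero_iff
    (measurable_ergodicComponent_apply μ hm)] at h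
  filter_upwards [h] with x hx
  exact measure_mono_null (subset_toMeasurable μ A) hx

lemma ergodicComponent_smul [Countable G] (g : G) (x : X) :
    ergodicComponent G μ (g • x) = ergodicComponent G μ x := by
  ext A hA
  have hmeas : MeasurableSet[invariantSigma G X]
      {y | ergodicComponent G μ y A = ergodicComponent G μ x A} :=
    measurable_condExpKernel hA (measurableSet_singleton _)
  have h := (measurableSet_invariantSigma_iff.1 hmeas).2 g
  have hx : x ∈ (fun x => g • x) ⁻¹' {y | ergodicComponent G μ y A = ergodicComponent G μ x A} := by
    rw [h]; rfl
  exact hx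

/-- The indicator of an invariant set is its own conditional expectation, so almost every component
gives `A` mass zero or one. -/
lemma ae_ergodicComponent_mem_iff [Countable G] {A : Set X} (hA : MeasurableSet A)
    (hinv : ∀ g : G, (fun x => g • x) ⁻¹' A = A) :
    ∀ᵐ x ∂μ, ∀ᵐ y ∂(ergodicComponent G μ x), y ∈ A ↔ x ∈ A := by
  have hI : invariantSigma G X ≤ (inferInstance : MeasurableSpace X) := invariantSigma_le
  have hAI : MeasurableSet[invariantSigma G X] A := measurableSet_invariantSigma_iff.2 ⟨hA, hinv⟩
  have h1 := condExpKernel_ae_eq_condExp (μ := μ) hI hA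
  rw [condExp_of_stronglyMeasurable hI (stronglyMeasurable_const.indicator hAI)
    ((integrable_const _).indicator hA)] at h1
  filter_upwards [h1] with x hx
  change (ergodicComponent G μ x).real A = _ at hx
  by_cases hxA : x ∈ A
  · rw [Set.indicator_of_mem hxA, measureReal_def, ENNReal.toReal_eq_one_iff,
      ← prob_compl_eq_zero_iff hA] at hx
    filter_upwards [measure_eq_zero_iff_ae_notMem.1 hx] with y hy
    simp only [Set.mem_compl_iff, not_not] at hy
    exact iff_of_true hy hxA
  · rw [Set.indicator_of_notMem hxA, measureReal_eq_zero_iff] at hx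
    filter_upwards [measure_eq_zero_iff_ae_notMem.1 hx] with y hy
    exact iff_of_false hy hxA

lemma ae_ergodicComponent_eq_of_invariant [Countable G] {φ : X → EReal} (hφ : Measurable φ)
    (hinv : ∀ (g : G) x, φ (g • x) = φ x) :
    ∀ᵐ x ∂μ, ∀ᵐ y ∂(ergodicComponent G μ x), φ y = φ x := by
  have h : ∀ᵐ x ∂μ, ∀ q : ℚ, ∀ᵐ y ∂(ergodicComponent G μ x),
      φ y < ((q : ℝ) : EReal) ↔ φ x < ((q : ℝ) : EReal) :=
    ae_all_iff.2 fun q => ae_ergodicComponent_mem_iff μ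
      (A := {x | φ x < ((q : ℝ) : EReal)}) (measurableSet_lt hφ measurable_const) fun g => by
        ext x; simp [hinv]
  filter_upwards [h] with x hx
  filter_upwards [ae_all_iff.2 hx] with y hy
  refine le_antisymm (not_lt.1 fun hlt => ?_) (not_lt.1 fun hlt => ?_)
  · obtain ⟨q, h1, h2⟩ := EReal.exists_rat_btwn_of_lt hlt
    exact absurd ((hy q).2 h1) (not_lt.2 h2.le)
  · obtain ⟨q, h1, h2⟩ := EReal.exists_rat_btwn_of_lt hlt
    exact absurd ((hy q).1 h1) (not_lt.2 h2.le)

open Classical in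
/-- The least value of the real embedding of `X` over the points of the orbit of `x` in `A`. -/
def orbitMin (G : Type*) {X : Type*} [Group G] [MulAction G X] [MeasurableSpace X]
    [StandardBorelSpace X] (A : Set X) (x : X) : EReal :=
  ⨅ g : G, if g • x ∈ A then ((embeddingReal X (g • x) : ℝ) : EReal) else ⊤

lemma measurable_orbitMin [Countable G] [MeasurableConstSMul G X] {A : Set X}
    (hA : MeasurableSet A) : Measurable (orbitMin G A) := by
  refine Measurable.iInf fun g => Measurable.ite (measurable_const_smul g hA) ?_ measurable_const
  exact measurable_coe_real_ereal.comp
    ((measurableEmbedding_embeddingReal X).measurable.comp (measurable_const_smul g))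

lemma orbitMin_smul (A : Set X) (g : G) (x : X) : orbitMin G A (g • x) = orbitMin G A x := by
  classical
  rw [orbitMin, orbitMin, ← (Equiv.mulRight g).iInf_comp (g := fun h : G =>
    if h • x ∈ A then ((embeddingReal X (h • x) : ℝ) : EReal) else ⊤)]
  refine iInf_congr fun h => ?_
  simp [mul_smul]

lemma exists_orbitMin_eq {A : Set X} {x : X} (hfin : {g : G | g • x ∈ A}.Finite)
    (hne : ∃ g : G, g • x ∈ A) :
    ∃ g : G, orbitMin G A x = ((embeddingReal X (g • x) : ℝ) : EReal) := by
  classical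
  obtain ⟨g, hg, hmin⟩ := Set.exists_min_image _ (fun g : G => embeddingReal X (g • x)) hfin hne
  refine ⟨g, le_antisymm ?_ (le_iInf fun h => ?_)⟩
  · exact (iInf_le _ g).trans_eq (if_pos hg)
  · split_ifs with hh
    · exact EReal.coe_le_coe_iff.2 (hmin h hh)
    · exact le_top

/-- A finite nonempty trace on `A` attains its minimum, and the real embedding is injective, so
equal minima come from a common point. The default `⊤` marks the orbits that miss `A`. -/
lemma mem_orbit_of_orbitMin_eq {A : Set X} {x y : X} (hx : {g : G | g • x ∈ A}.Finite)
    (hy : {g : G | g • y ∈ A}.Finite) (hne : ∃ g : G, g • x ∈ A)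
    (h : orbitMin G A y = orbitMin G A x) : y ∈ MulAction.orbit G x := by
  classical
  obtain ⟨g, hg⟩ := exists_orbitMin_eq hx hne
  have hne' : ∃ g : G, g • y ∈ A := by
    by_contra hcon
    push Not at hcon
    have : orbitMin G A y = ⊤ := by simp [orbitMin, hcon]
    rw [h, hg] at this
    exact EReal.coe_ne_top _ this
  obtain ⟨g', hg'⟩ := exists_orbitMin_eq hy hne'
  rw [hg, hg', EReal.coe_eq_coe_iff] at h
  have heq : g' • y = g • x := (measurableEmbedding_embeddingReal X).injective h
  refine ⟨g'⁻¹ * g, ?_⟩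
  simp only [mul_smul, ← heq, inv_smul_smul]

/-- By Borel–Cantelli almost every orbit meets each `s n` for finitely many group elements. The
invariants `orbitMin` then confine almost every component to one orbit, and stabilizers are finite
because a stabilizing element is a return. -/
lemma isDissipativeUpToCompactStabilizers_of_isOrbitSigmaFinite [Countable G]
    [MeasurableConstSMul G X] (hns : IsNonsingularAction G μ) (h : IsOrbitSigmaFinite G μ) :
    IsDissipativeUpToCompactStabilizers G μ := by
  obtain ⟨s, hs, hfin, hcov⟩ := h
  have hret : ∀ᵐ x ∂μ, ∀ n, {g : G | g • x ∈ s n}.Finite := by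
    refine ae_all_iff.2 fun n => ?_
    have := hfin n
    rw [orbitMeasure_apply G μ (hs n)] at this
    exact ae_finite_setOfPred_mem this
  have hX : ∀ᵐ x ∂μ, (∀ n, {g : G | g • x ∈ s n}.Finite) ∧ ∃ n, x ∈ s n := by
    filter_upwards [hret, measure_eq_zero_iff_ae_notMem.1 hcov] with x hx1 hx2
    exact ⟨hx1, by simpa using hx2⟩
  have horb : ∀ᵐ x ∂μ, ergodicComponent G μ x (MulAction.orbit G x)ᶜ = 0 := by
    filter_upwards [hX, ae_ergodicComponent_eq_zero (G := G) μ hX, ae_all_iff.2 fun n =>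
      ae_ergodicComponent_eq_of_invariant μ (measurable_orbitMin (G := G) (hs n))
        (orbitMin_smul (s n))] with x hx hx2 hx3
    obtain ⟨hxfin, n, hxn⟩ := hx
    have hx2' : ∀ᵐ y ∂(ergodicComponent G μ x),
        (∀ n, {g : G | g • y ∈ s n}.Finite) ∧ ∃ n, y ∈ s n := hx2
    have : ∀ᵐ y ∂(ergodicComponent G μ x), y ∈ MulAction.orbit G x := by
      filter_upwards [hx2', hx3 n] with y hy1 hy2
      exact mem_orbit_of_orbitMin_eq (hxfin n) (hy1.1 n) ⟨1, by simpa using hxn⟩ hy2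
    exact this
  -- Viewing the kernel over the full σ-algebra allows the diagonal to be used for measurability of
  -- the mass each point receives from its own component.
  let κ : Kernel X X := (condExpKernel μ (invariantSigma G X)).comap id
    (measurable_id'' invariantSigma_le)
  have hN : MeasurableSet {y | ergodicComponent G μ y {y} = 0} := by
    have hm : Measurable fun y => κ y (Prod.mk y ⁻¹' Set.diagonal X) :=
      Kernel.measurable_kernel_prodMk_left measurableSet_diagonal
    have heq : (fun y => κ y (Prod.mk y ⁻¹' Set.diagonal X)) =
        fun y => ergodicComponent G μ y {y} := by
      funext y
      have : Prod.mk y ⁻¹' Set.diagonal X = {y} := by ext z; simp [eq_comm]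
      rw [this]; rfl
    rw [heq] at hm
    exact hm (measurableSet_singleton 0)
  -- A component lives on a countable orbit, along which components coincide, so it gives the points
  -- that it does not charge total mass zero.
  have hN0 : μ {y | ergodicComponent G μ y {y} = 0} = 0 := by
    rw [← lintegral_ergodicComponent (G := G) μ hN, lintegral_eq_zero_iff
      (measurable_ergodicComponent_apply μ hN)]
    filter_upwards [horb] with x hx
    refine measure_mono_null (t := (MulAction.orbit G x)ᶜ ∪ ⋃ g ∈ {g : G |
      ergodicComponent G μ (g • x) {g • x} = 0}, {g • x}) (fun y hy => ?_)
      (measure_union_null hx ?_)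
    · by_cases hyx : y ∈ MulAction.orbit G x
      · obtain ⟨g, rfl⟩ := hyx
        exact Or.inr (Set.mem_biUnion (x := g) hy rfl)
      · exact Or.inl hyx
    · refine (measure_biUnion_null_iff (Set.to_countable _)).2 fun g hg => ?_
      rw [← ergodicComponent_smul μ g x]
      exact hg
  have hcharge : ∀ᵐ x ∂μ, ∀ g : G, ergodicComponent G μ (g • x) {g • x} ≠ 0 := by
    refine ae_all_iff.2 fun g => ?_
    have := (hns g).1 hN0
    rw [Measure.map_apply (measurable_const_smul g) hN] at this
    exact measure_eq_zero_iff_ae_notMem.1 this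
  filter_upwards [hX, horb, hcharge] with x hx hxo hxc
  refine ⟨x, ?_, hxo, ?_⟩
  · obtain ⟨hxfin, n, hxn⟩ := hx
    refine (hxfin n).subset fun g hg => ?_
    have hgx : g • x = x := hg
    change g • x ∈ s n
    rwa [hgx]
  · rintro _ ⟨g, rfl⟩
    have := hxc g
    rwa [ergodicComponent_smul μ g x] at this

end Dissipative

/-! ### Absence of atoms and essential freeness -/

section EssentiallyFree

variable {G : Type v} {X₀ : Type u}

/-- Take a maximal `S` disjoint from its translate by `g`: an element that cannot be added is in `S`
or has a neighbour in `S` under translation by `g`. -/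
lemma exists_triple_cover [Group G] (g : G) (hg : g ≠ 1) :
    ∃ S : Set G, (∀ h ∈ S, g⁻¹ * h ∉ S) ∧ ∀ h, h ∈ S ∨ g⁻¹ * h ∈ S ∨ g * h ∈ S := by
  obtain ⟨S, hS⟩ := zorn_subset {S : Set G | ∀ h ∈ S, g⁻¹ * h ∉ S} (by
    intro c hc hchain
    refine ⟨⋃₀ c, ?_, fun s hs => Set.subset_sUnion_of_mem hs⟩
    rintro h ⟨s, hs, hhs⟩ ⟨s', hs', hhs'⟩
    rcases hchain.total hs hs' with hle | hle
    · exact hc hs' h (hle hhs) hhs'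
    · exact hc hs h hhs (hle hhs'))
  refine ⟨S, hS.prop, fun h => ?_⟩
  by_contra! hcon
  obtain ⟨h1, h2, h3⟩ := hcon
  have hins : insert h S ∈ {S : Set G | ∀ h ∈ S, g⁻¹ * h ∉ S} := by
    rintro k (rfl | hk) (hk' | hk')
    · exact hg (by simpa using hk')
    · exact h2 hk'
    · exact h3 (by rw [← hk']; simpa using hk)
    · exact hS.prop k hk hk'
  exact h1 (hS.le_of_ge hins (Set.subset_insert h S) (Set.mem_insert h S))

open Classical in
/-- The point whose coordinates in `T` are those of `x` and whose other coordinates are those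
of `y`. -/
def splice (T : Set G) (x y : BernoulliSpace G X₀) : BernoulliSpace G X₀ :=
  fun h => if h ∈ T then x h else y h

lemma splice_of_mem {T : Set G} {h : G} (hh : h ∈ T) (x y : BernoulliSpace G X₀) :
    splice T x y h = x h := if_pos hh

lemma splice_of_notMem {T : Set G} {h : G} (hh : h ∉ T) (x y : BernoulliSpace G X₀) :
    splice T x y h = y h := if_neg hh

variable [MeasurableSpace X₀]

lemma measurable_coordinate (h : G) : Measurable fun x : BernoulliSpace G X₀ => x h :=
  measurable_pi_apply (X := fun _ : G => X₀) h

lemma measurePreserving_splice (μ : G → Measure X₀) [∀ g, IsProbabilityMeasure (μ g)]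
    (T : Set G) :
    MeasurePreserving (fun p : BernoulliSpace G X₀ × BernoulliSpace G X₀ => splice T p.1 p.2)
      ((bernoulliProductMeasure μ).prod (bernoulliProductMeasure μ))
      (bernoulliProductMeasure μ) :=
  measurePreserving_infinitePi_ite μ T

/-- The common minorant is not carried by one point, which bounds all atoms of all marginals by
$1-c$ with a single $c>0$. -/
lemma bernoulliProductMeasure_singleton_eq_zero [Group G] [Infinite G]
    [MeasurableSingletonClass X₀] (μ : G → Measure X₀)
    [∀ g, IsProbabilityMeasure (μ g)] (hμ : HasCommonMinorant μ)
    (hatom : ∀ (g : G) (a : X₀), μ g {a} ≠ 1) (x : BernoulliSpace G X₀) :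
    bernoulliProductMeasure μ {x} = 0 := by
  obtain ⟨ρ, hfin, hρ, hac⟩ := hμ
  have hρa : ∀ a, ρ {a}ᶜ ≠ 0 := fun a h0 =>
    hatom 1 a ((prob_compl_eq_zero_iff (measurableSet_singleton a)).1 (hac 1 h0))
  obtain ⟨c, hc0, hc⟩ : ∃ c : ENNReal, c ≠ 0 ∧ ∀ a, c ≤ ρ {a}ᶜ := by
    by_cases hex : ∃ a₀, ρ {a₀} ≠ 0
    · obtain ⟨a₀, ha₀⟩ := hex
      -- The complement of any point other than `a₀` contains `a₀`.
      refine ⟨min (ρ {a₀}) (ρ {a₀}ᶜ), (lt_min (pos_iff_ne_zero.2 ha₀)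
        (pos_iff_ne_zero.2 (hρa a₀))).ne', fun a => ?_⟩
      by_cases ha : a = a₀
      · rw [ha]; exact min_le_right _ _
      · exact (min_le_left _ _).trans (measure_mono (by simpa [eq_comm] using ha))
    · push Not at hex
      refine ⟨ρ Set.univ, fun h0 => hρa (x 1) (measure_mono_null (Set.subset_univ _) h0),
        fun a => ?_⟩
      rw [measure_compl (measurableSet_singleton a) (measure_ne_top _ _), hex a, tsub_zero]
  have hle : ∀ (g : G) (a : X₀), μ g {a} ≤ 1 - c := by
    intro g a
    have h1 := prob_compl_eq_one_sub (μ := μ g) (measurableSet_singleton a).compl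
    rw [compl_compl] at h1
    rw [h1]
    exact tsub_le_tsub_left ((hc a).trans (hρ g _)) 1
  have hpow : ∀ n : ℕ, bernoulliProductMeasure μ {x} ≤ (1 - c) ^ n := by
    intro n
    obtain ⟨s, hs⟩ := Infinite.exists_subset_card_eq G n
    calc bernoulliProductMeasure μ {x} ≤
        Measure.infinitePi μ (Set.pi (s : Set G) fun h => {x h}) :=
          measure_mono (by rintro _ rfl; exact fun h _ => rfl)
      _ = ∏ h ∈ s, μ h {x h} := Measure.infinitePi_pi μ fun h _ => measurableSet_singleton _
      _ ≤ ∏ _h ∈ s, (1 - c) := Finset.prod_le_prod' fun h _ => hle h _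
      _ = (1 - c) ^ n := by simp [hs]
  have hlt : 1 - c < 1 := ENNReal.sub_lt_self ENNReal.one_ne_top one_ne_zero hc0
  exact le_antisymm (ge_of_tendsto' (ENNReal.tendsto_pow_atTop_nhds_zero_of_lt_one hlt) hpow)
    zero_le

variable [StandardBorelSpace X₀] [Countable G]

lemma measurableSet_forall_eq {Ω : Type*} [MeasurableSpace Ω] (T : Set G) {a b : G → Ω → X₀}
    (ha : ∀ h, Measurable (a h)) (hb : ∀ h, Measurable (b h)) :
    MeasurableSet {x | ∀ h ∈ T, a h x = b h x} := by
  have : {x | ∀ h ∈ T, a h x = b h x} = ⋂ h ∈ T, {x | a h x = b h x} :=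
    Set.ext fun x => ⟨fun h => Set.mem_iInter₂.2 h, fun h => Set.mem_iInter₂.1 h⟩
  rw [this]
  exact MeasurableSet.biInter (Set.to_countable _) fun h _ => measurableSet_eq_fun (ha h) (hb h)

/-- For a fixed point the pattern on `T` is copied from $g^{-1}T$, which is disjoint from `T`. Two
independent patterns agree with positive probability only if some single pattern is charged. -/
lemma exists_charged_of_fixed [Group G] (μ : G → Measure X₀) [∀ g, IsProbabilityMeasure (μ g)] {g : G}
    (hfix : bernoulliProductMeasure μ {x | g • x = x} ≠ 0) {T : Set G}
    (hT : ∀ h ∈ T, g⁻¹ * h ∉ T) :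
    ∃ v : BernoulliSpace G X₀, bernoulliProductMeasure μ {x | ∀ h ∈ T, x h = v h} ≠ 0 := by
  by_contra! hcon
  refine hfix ?_
  have hA : MeasurableSet {x : BernoulliSpace G X₀ | ∀ h ∈ T, x h = x (g⁻¹ * h)} :=
    measurableSet_forall_eq T measurable_coordinate fun h => measurable_coordinate (g⁻¹ * h)
  have hB : MeasurableSet {p : BernoulliSpace G X₀ × BernoulliSpace G X₀ |
      ∀ h ∈ T, p.1 h = p.2 (g⁻¹ * h)} :=
    measurableSet_forall_eq T (fun h => (measurable_coordinate h).comp measurable_fst)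
      fun h => (measurable_coordinate (g⁻¹ * h)).comp measurable_snd
  refine measure_mono_null (t := {x | ∀ h ∈ T, x h = x (g⁻¹ * h)})
    (fun x hx h _ => (congrFun hx h).symm) ?_
  rw [← (measurePreserving_splice μ T).measure_preimage hA.nullMeasurableSet]
  have hpre : (fun p : BernoulliSpace G X₀ × BernoulliSpace G X₀ => splice T p.1 p.2) ⁻¹'
      {x | ∀ h ∈ T, x h = x (g⁻¹ * h)} = {p | ∀ h ∈ T, p.1 h = p.2 (g⁻¹ * h)} := by
    ext p
    refine forall₂_congr fun h hh => ?_
    change splice T p.1 p.2 h = splice T p.1 p.2 (g⁻¹ * h) ↔ _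
    rw [splice_of_mem hh, splice_of_notMem (hT h hh)]
  rw [hpre, Measure.prod_apply_symm hB,
    lintegral_eq_zero_iff (measurable_measure_prodMk_right hB)]
  exact .of_forall fun y => hcon (g • y)

lemma exists_charged_union (μ : G → Measure X₀) [∀ g, IsProbabilityMeasure (μ g)]
    {T T' : Set G} {v v' : BernoulliSpace G X₀}
    (hv : bernoulliProductMeasure μ {x | ∀ h ∈ T, x h = v h} ≠ 0)
    (hv' : bernoulliProductMeasure μ {x | ∀ h ∈ T', x h = v' h} ≠ 0) :
    ∃ w : BernoulliSpace G X₀, bernoulliProductMeasure μ {x | ∀ h ∈ T ∪ T', x h = w h} ≠ 0 := by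
  refine ⟨splice T v v', fun h0 => mul_ne_zero hv hv' ?_⟩
  rw [← Measure.prod_prod]
  have hm : MeasurableSet {x : BernoulliSpace G X₀ | ∀ h ∈ T ∪ T', x h = splice T v v' h} :=
    measurableSet_forall_eq (T ∪ T') measurable_coordinate fun h => measurable_const
  rw [← (measurePreserving_splice μ T).measure_preimage hm.nullMeasurableSet] at h0
  refine measure_mono_null ?_ h0
  rintro ⟨x, y⟩ ⟨hx, hy⟩ h hh
  change splice T x y h = splice T v v' h
  by_cases hhT : h ∈ T
  · rw [splice_of_mem hhT, splice_of_mem hhT]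
    exact hx h hhT
  · rw [splice_of_notMem hhT, splice_of_notMem hhT]
    exact hy h (hh.resolve_left hhT)

/-- If `g ≠ 1` fixed a set of positive measure, charged patterns on the three sets of the cover
would glue to an atom of the product measure. -/
lemma isEssentiallyFreeAction_of_forall_singleton [Group G] (μ : G → Measure X₀)
    [∀ g, IsProbabilityMeasure (μ g)] (h : ∀ x, bernoulliProductMeasure μ {x} = 0) :
    IsEssentiallyFreeAction G (bernoulliProductMeasure μ) := by
  have hnull : ∀ g : G, g ≠ 1 → bernoulliProductMeasure μ {x | g • x = x} = 0 := by
    intro g hg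
    by_contra hfix
    obtain ⟨S, hS, hcov⟩ := exists_triple_cover g hg
    obtain ⟨v₁, h₁⟩ := exists_charged_of_fixed μ hfix hS
    obtain ⟨v₂, h₂⟩ := exists_charged_of_fixed μ hfix (T := {h | g⁻¹ * h ∈ S})
      fun k hk => hS _ hk
    obtain ⟨v₃, h₃⟩ := exists_charged_of_fixed μ hfix (T := {h | g * h ∈ S}) fun k hk hk' => by
      refine hS _ hk ?_
      simpa using hk'
    obtain ⟨v₄, h₄⟩ := exists_charged_union μ h₂ h₃
    obtain ⟨v₅, h₅⟩ := exists_charged_union μ h₁ h₄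
    refine h₅ (measure_mono_null (fun x hx => ?_) (h v₅))
    exact funext fun k => hx k (hcov k)
  have : ∀ᵐ x ∂(bernoulliProductMeasure μ), ∀ g : G, g ≠ 1 → g • x ≠ x := by
    refine ae_all_iff.2 fun g => ?_
    by_cases hg : g = 1
    · simp [hg]
    · filter_upwards [measure_eq_zero_iff_ae_notMem.1 (hnull g hg)] with x hx _
      exact hx
  filter_upwards [this] with x hx
  rw [eq_bot_iff]
  intro g hg
  by_contra hne
  exact hx g (fun h1 => hne (by simpa using h1)) hg

end EssentiallyFree

/-! ### Common minorants under the two conditions on ν -/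

section PhaseTransition

variable {G : Type v} {X₀ : Type u} [MeasurableSpace X₀]

lemma hasCommonMinorant_mixture_of_equiv [Group G] {μ : G → Measure X₀} {ν : Measure X₀}
    [IsFiniteMeasure ν] (hequiv : ∀ g h : G, μ g ≪ μ h) (hν : μ 1 ≪ ν) {t : I} (ht : t < 1) :
    HasCommonMinorant (mixture ν μ t) := by
  have ht' : 0 < 1 - (t : ℝ) := sub_pos.2 ht
  have hc : ENNReal.ofReal (1 - (t : ℝ)) ≠ 0 := by simpa using ht'
  refine ⟨ENNReal.ofReal (1 - (t : ℝ)) • ν, Measure.smul_finite ν ENNReal.ofReal_ne_top,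
    fun g => Measure.le_add_right le_rfl, fun g => ?_⟩
  have h1 : ν ≪ ENNReal.ofReal (1 - (t : ℝ)) • ν := Measure.absolutelyContinuous_smul hc
  exact Measure.AbsolutelyContinuous.add_left_iff.2 ⟨h1.smul_left _,
    (((hequiv g 1).trans hν).trans h1).smul_left _⟩

/-- The infimum over `g` of the densities is a density below all `μ g`; the pointwise logarithmic
bound keeps it positive almost everywhere. -/
lemma hasCommonMinorant_mixture_of_bounded [Group G] [Countable G] {μ : G → Measure X₀}
    [∀ g, IsProbabilityMeasure (μ g)] {ν : Measure X₀}
    (hequiv : ∀ g h : G, μ g ≪ μ h) (hν : ν ≪ μ 1) (hb : HasBoundedLogDensities μ) {t : I}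
    (ht : 0 < t) : HasCommonMinorant (mixture ν μ t) := by
  have ht' : 0 < (t : ℝ) := ht
  have hc : ENNReal.ofReal (t : ℝ) ≠ 0 := by simpa using ht'
  let f : X₀ → ENNReal := fun x => ⨅ g : G, (μ g).rnDeriv (μ 1) x
  have hf : Measurable f := Measurable.iInf fun g => Measure.measurable_rnDeriv _ _
  have hle : ∀ g, (μ 1).withDensity f ≤ μ g := fun g =>
    (withDensity_mono (.of_forall fun x => iInf_le _ g)).trans (Measure.withDensity_rnDeriv_le _ _)
  have hpos : ∀ᵐ x ∂(μ 1), f x ≠ 0 := by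
    have hfin : ∀ᵐ x ∂(μ 1), ∀ g, 0 < ((μ g).rnDeriv (μ 1) x).toReal := by
      refine ae_all_iff.2 fun g => ?_
      filter_upwards [(hequiv 1 g).ae_le (Measure.rnDeriv_pos (hequiv g 1)),
        Measure.rnDeriv_lt_top (μ g) (μ 1)] with x h1 h2
      exact ENNReal.toReal_pos h1.ne' h2.ne
    filter_upwards [hb, hfin] with x ⟨C, hC⟩ hx
    have hlow : ENNReal.ofReal (Real.exp (-C)) ≤ f x := by
      refine le_iInf fun g => ENNReal.ofReal_le_of_le_toReal ?_
      rw [← Real.le_log_iff_exp_le (hx g)]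
      exact (abs_le.1 (hC g)).1
    exact ((ENNReal.ofReal_pos.2 (Real.exp_pos _)).trans_le hlow).ne'
  have hac : μ 1 ≪ ENNReal.ofReal (t : ℝ) • (μ 1).withDensity f :=
    (withDensity_absolutelyContinuous' hf.aemeasurable hpos).trans
      (Measure.absolutelyContinuous_smul hc)
  have hfin : IsFiniteMeasure ((μ 1).withDensity f) := isFiniteMeasure_of_le (μ 1) (hle 1)
  refine ⟨ENNReal.ofReal (t : ℝ) • (μ 1).withDensity f,
    Measure.smul_finite _ ENNReal.ofReal_ne_top, fun g => Measure.le_add_left ?_, fun g => ?_⟩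
  · exact Measure.le_iff.2 fun s _ => mul_le_mul_right (hle g s) _
  · exact Measure.AbsolutelyContinuous.add_left_iff.2 ⟨(hν.trans hac).smul_left _,
      ((hequiv g 1).trans hac).smul_left _⟩

lemma mixture_singleton_ne_one [MeasurableSingletonClass X₀] {μ : G → Measure X₀}
    [∀ g, IsProbabilityMeasure (μ g)] {ν : Measure X₀} [IsProbabilityMeasure ν]
    (hatom : ∀ (g : G) (x : X₀), μ g {x} ≠ 1) {t : I} (ht : 0 < t) (g : G) (x : X₀) :
    mixture ν μ t g {x} ≠ 1 := by
  have ht' : 0 < (t : ℝ) := ht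
  intro h
  rw [← prob_compl_eq_zero_iff (measurableSet_singleton x)] at h
  have h2 : ENNReal.ofReal (t : ℝ) * μ g {x}ᶜ = 0 := (add_eq_zero.1 h).2
  rcases mul_eq_zero.1 h2 with h3 | h3
  · simp at h3
    linarith
  · exact hatom g x ((prob_compl_eq_zero_iff (measurableSet_singleton x)).1 h3)

lemma exists_mul_eq_of_lt {s t : I} (hst : s < t) : ∃ r : I, r < 1 ∧ r * t = s := by
  have hst' : (s : ℝ) < t := hst
  have ht : (0 : ℝ) < t := s.2.1.trans_lt hst'
  refine ⟨⟨s / t, div_nonneg s.2.1 t.2.1, (div_le_one ht).2 hst'.le⟩, ?_, ?_⟩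
  · exact (div_lt_one ht).2 hst'
  · exact Subtype.ext (div_mul_cancel₀ _ ht.ne')

end PhaseTransition

end

theorem theorem3p1 {G : Type v} [Group G] [Countable G] [Infinite G]
    {X₀ : Type u} [MeasurableSpace X₀] [StandardBorelSpace X₀]
    (μ : G → Measure X₀) [∀ g, IsProbabilityMeasure (μ g)]
    (ν : Measure X₀) [IsProbabilityMeasure ν]
    -- the measures `μ g` are mutually equivalent
    (hequiv : ∀ g h : G, μ g ≪ μ h)
    -- they are not supported on a single atom
    (hatom : ∀ (g : G) (x : X₀), μ g {x} ≠ 1)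
    (hns : IsNonsingularAction G (bernoulliProductMeasure μ)) :
    (∀ t : I, IsNonsingularAction G (bernoulliProductMeasure (mixture ν μ t))) ∧
    ((ν ≪ μ 1 ∧ μ 1 ≪ ν) ∨ (ν ≪ μ 1 ∧ HasBoundedLogDensities μ) →
      ∃ t₁ : I,
        (∀ t : I, t < t₁ →
          IsWeaklyMixingAction.{w, v, max v u} G (bernoulliProductMeasure (mixture ν μ t))) ∧
        (∀ t : I, t₁ < t →
          IsDissipativeUpToCompactStabilizers G (bernoulliProductMeasure (mixture ν μ t)) ∧
          (t < 1 ∨ (∀ x, bernoulliProductMeasure μ {x} = 0) ∨ HasBoundedLogDensities μ →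
            IsDissipativeAction G (bernoulliProductMeasure (mixture ν μ t))))) := by
  have hnst : ∀ t : I, IsNonsingularAction G (bernoulliProductMeasure (mixture ν μ t)) := by
    intro t
    rw [← bernoulliProductMeasure_mixture_one ν μ] at hns
    have := isNonsingularAction_mixture_mul ν μ 1 t hns
    rwa [mul_one] at this
  refine ⟨hnst, fun hcase => ?_⟩
  have hν : ν ≪ μ 1 := hcase.elim (·.1) (·.1)
  have hminor : ∀ t : I, 0 < t → t < 1 → HasCommonMinorant (mixture ν μ t) := by
    intro t h0 h1
    rcases hcase with h | h
    · exact hasCommonMinorant_mixture_of_equiv hequiv h.2 h1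
    · exact hasCommonMinorant_mixture_of_bounded hequiv h.1 h.2 h0
  -- If `R` is empty its supremum is `0`, and the weak mixing claim is vacuous.
  let R : Set I := {t | ¬ IsOrbitSigmaFinite G (bernoulliProductMeasure (mixture ν μ t))}
  refine ⟨sSup R, fun t ht => ?_, fun t ht => ?_⟩
  · obtain ⟨t', ht', htt'⟩ := lt_sSup_iff.1 ht
    -- The intermediate `s` lies strictly between `0` and `1`, where a common minorant exists; at
    -- `t'`, which may equal `1`, it may fail.
    obtain ⟨s, hts, hst'⟩ := exists_between htt'
    obtain ⟨q, -, rfl⟩ := exists_mul_eq_of_lt hst'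
    have hs : ¬ IsOrbitSigmaFinite G (bernoulliProductMeasure (mixture ν μ (q * t'))) :=
      fun h => ht' h.of_mixture_mul
    have hinf := (isOrbitSigmaFinite_or_isOrbitInfinite _ (hminor (q * t')
      (t.2.1.trans_lt hts) (hst'.trans_le t'.2.2))).resolve_left hs
    obtain ⟨r, hr, rfl⟩ := exists_mul_eq_of_lt hts
    exact isWeaklyMixingAction_of_isOrbitInfinite ν μ _ r hr (hnst _) hinf
  · have hσ : IsOrbitSigmaFinite G (bernoulliProductMeasure (mixture ν μ t)) := by
      by_contra h
      exact absurd (le_sSup (show t ∈ R from h)) (not_le.2 ht)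
    have h0 : 0 < t := (zero_le : (0 : I) ≤ sSup R).trans_lt ht
    have hdis := isDissipativeUpToCompactStabilizers_of_isOrbitSigmaFinite _ (hnst t) hσ
    refine ⟨hdis, fun hfree => ⟨isEssentiallyFreeAction_of_forall_singleton _ fun x => ?_, hdis⟩⟩
    -- A common minorant excludes atoms. It can be missing only at `t = 1` without the logarithmic
    -- bound, and there the absence of atoms is assumed.
    by_cases hm : HasCommonMinorant (mixture ν μ t)
    · exact bernoulliProductMeasure_singleton_eq_zero _ hm (mixture_singleton_ne_one hatom h0) x
    rcases hfree with h1 | hna | hb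
    · exact absurd (hminor t h0 h1) hm
    · have ht1 : t = 1 := by
        by_contra hne
        exact hm (hminor t h0 (lt_of_le_of_ne t.2.2 hne))
      subst ht1
      rw [bernoulliProductMeasure_mixture_one]
      exact hna x
    · exact absurd (hasCommonMinorant_mixture_of_bounded hequiv hν hb h0) hm
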